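/- Fix $\nu\in(0,1)$ and put $w=\tfrac12$, $\mu=w(1-\nu)$. For $L\ge 2$ consider on the torus $\mathbb Z/L\mathbb Z$, with configurations $\eta\in\{0,1\}^{\mathbb Z/L\mathbb Z}$, the continuous-time Markov chain (diffusion-limited pair annihilation and deposition) in which, for each $k$, the occupation numbers of the sites $k,k+1$ are simultaneously flipped, $\eta\mapsto\bar\eta^{k,k+1}$, with rate $\mu+w(\eta_k+\eta_{k+1})$. The activity $A(t)$ is the number of particle jumps up to time $t$: the pair $(\eta(t),A(t))$, with $A(0)=0$, is the Markov process on $\{0,1\}^{\mathbb Z/L\mathbb Z}\times\mathbb N_0$ with generator $$(\tilde{\mathcal H}f)(\eta,A)=\sum_{k=0}^{L-1}\Big[\mu f(\bar\eta^{k,k+1},A)+w(\eta_k+\eta_{k+1})f(\bar\eta^{k,k+1},A+1)-\big(\mu+w(\eta_k+\eta_{k+1})\big)f(\eta,A)\Big].$$ For every $L\ge2$, every $s\in\mathbb R$ and every initial configuration $\eta$ with an even number of particles, $\mathbb E_{\eta}[e^{sA(t)}]<\infty$ for all $t\ge 0$, and the limit $$K(L,s)=\lim_{t\to\infty}\frac1{Lt}\ln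 \mathbb E_{\eta}\big[e^{sA(t)}\big]$$ exists, does not depend on $\eta$, and is a smooth function of $s$. Put $s_c=\ln(1-\mu/w)=\ln\nu$, let $\kappa^c_n(L)=\frac{d^n}{ds^n}K(L,s)\big|_{s=s_c}$ be the cumulants at the critical point, and put $$\kappa_0^*=\frac\nu2-1+\frac1\pi\Big(\frac{\arcsin\nu}{\nu}+\sqrt{1-\nu^2}\Big),\qquad \xi=\frac1{\sqrt{1-\nu^2}},\qquad c=\frac12,$$ $$K_0(L,u)=\xi\Big[K(L,s_c+u/L)-\kappa_0^*-\frac uL\,\kappa^c_1(L)-\frac{u^2}{2L^2}\,\kappa^c_2(L)\Big],$$ $$h(u)=\sum_{r=0}^\infty\Big(\sqrt{u^2+\pi^2(2r+1)^2}-\pi(2r+1)-\frac{u^2}{2\pi(2r+1)}\Big),$$ where the series converges for all real $u$. Then for every $u\in\mathbb R$ $$\lim_{L\to\infty}L^2K_0(L,u)=\frac{\pi c}{6}+h\big(\sqrt{\xi^2-1}\,u\big).$$ -/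

import Mathlib

open Filter Topology
open scoped ENNReal ContDiff

noncomputable section

namespace DLPAD

/-! ### Configurations on the integer torus and the dynamics -/

/-- Particle configurations on the torus `ℤ/Lℤ`, with at most one particle per site
(`true` means occupied). -/
abbrev Config (L : ℕ) : Type := ZMod L → Bool

/-- The occupation number of site `k`, as a real number in `{0, 1}`. -/
def occ {L : ℕ} (η : Config L) (k : ZMod L) : ℝ := if η k then 1 else 0

/-- The configuration in which the occupation of the sites `k` and `k + 1` is flipped. -/
def flip {L : ℕ} (η : Config L) (k : ZMod L) : Config L :=
  fun j => if j = k ∨ j = k + 1 then !(η j) else η j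

/-- The total number of particles. -/
def particleNumber {L : ℕ} (η : Config L) : ℕ :=
  ∑ k ∈ Finset.range L, if η (k : ZMod L) then 1 else 0

/-- The empty configuration. -/
def emptyConfig (L : ℕ) : Config L := fun _ => false

/-- States of the joint process: configuration and activity (number of jumps so far). -/
abbrev JointState (L : ℕ) : Type := Config L × ℕ

/-- Bounded real functions on the joint state space, with the supremum norm. -/
abbrev BoundedFun (L : ℕ) : Type := lp (fun _ : JointState L => ℝ) ∞

/-- The expression of the generator of the joint process `(η(t), A(t))`. A pair deposition (rate
`μ`) leaves the activity unchanged, a particle jump (rate `w` per particle) increases it by one. -/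
def jointGenFun (μ w : ℝ) (L : ℕ) (f : JointState L → ℝ) (x : JointState L) : ℝ :=
  ∑ k ∈ Finset.range L,
    (μ * f (flip x.1 k, x.2)
      + w * (occ x.1 k + occ x.1 ((k : ZMod L) + 1)) * f (flip x.1 k, x.2 + 1)
      - (μ + w * (occ x.1 k + occ x.1 ((k : ZMod L) + 1))) * f x)

theorem abs_jointGenFun_le (μ w : ℝ) (L : ℕ) (f : JointState L → ℝ) (C : ℝ)
    (hf : ∀ x, |f x| ≤ C) (x : JointState L) :
    |jointGenFun μ w L f x| ≤ L * (2 * |μ| + 4 * |w|) * C := by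
  have hC : 0 ≤ C := (abs_nonneg _).trans (hf x)
  have hocc : ∀ k : ZMod L, 0 ≤ occ x.1 k ∧ occ x.1 k ≤ 1 := by
    intro k
    unfold occ
    split_ifs <;> norm_num
  have hterm : ∀ k ∈ Finset.range L,
      |μ * f (flip x.1 k, x.2)
        + w * (occ x.1 k + occ x.1 ((k : ZMod L) + 1)) * f (flip x.1 k, x.2 + 1)
        - (μ + w * (occ x.1 k + occ x.1 ((k : ZMod L) + 1))) * f x|
      ≤ (2 * |μ| + 4 * |w|) * C := by
    intro k _
    obtain ⟨h1, h2⟩ := hocc k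
    obtain ⟨h3, h4⟩ := hocc ((k : ZMod L) + 1)
    set o := occ x.1 (k : ZMod L) + occ x.1 ((k : ZMod L) + 1) with ho
    have ho2 : |o| ≤ 2 := by
      rw [abs_of_nonneg (by linarith)]
      linarith
    have hwo : |w * o| ≤ 2 * |w| := by
      rw [abs_mul]
      nlinarith [abs_nonneg w]
    have e1 : |μ * f (flip x.1 k, x.2)| ≤ |μ| * C := by
      rw [abs_mul]
      exact mul_le_mul_of_nonneg_left (hf _) (abs_nonneg _)
    have e2 : |w * o * f (flip x.1 k, x.2 + 1)| ≤ 2 * |w| * C := by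
      rw [abs_mul]
      exact mul_le_mul hwo (hf _) (abs_nonneg _) (by positivity)
    have e3 : |(μ + w * o) * f x| ≤ (|μ| + 2 * |w|) * C := by
      rw [abs_mul]
      exact mul_le_mul ((abs_add_le _ _).trans (by linarith)) (hf _) (abs_nonneg _) (by positivity)
    have e4 := abs_sub (μ * f (flip x.1 k, x.2) + w * o * f (flip x.1 k, x.2 + 1))
      ((μ + w * o) * f x)
    have e5 := abs_add_le (μ * f (flip x.1 k, x.2)) (w * o * f (flip x.1 k, x.2 + 1))
    linarith
  calc |jointGenFun μ w L f x|
      ≤ ∑ k ∈ Finset.range L, _ := Finset.abs_sum_le_sum_abs _ _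
    _ ≤ ∑ k ∈ Finset.range L, (2 * |μ| + 4 * |w|) * C := Finset.sum_le_sum hterm
    _ = L * (2 * |μ| + 4 * |w|) * C := by
      rw [Finset.sum_const, Finset.card_range, nsmul_eq_mul, mul_assoc]

theorem memℓp_jointGenFun (μ w : ℝ) (L : ℕ) (f : BoundedFun L) :
    Memℓp (E := fun _ : JointState L => ℝ) (jointGenFun μ w L f) ∞ := by
  refine memℓp_infty ⟨L * (2 * |μ| + 4 * |w|) * ‖f‖, ?_⟩
  rintro _ ⟨x, rfl⟩
  exact abs_jointGenFun_le μ w L f ‖f‖ (fun y => lp.norm_apply_le_norm ENNReal.top_ne_zero f y) x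

/-- The generator of the joint process as a bounded operator on bounded functions. -/
def jointGenerator (μ w : ℝ) (L : ℕ) : BoundedFun L →L[ℝ] BoundedFun L :=
  LinearMap.mkContinuous
    { toFun := fun f => ⟨jointGenFun μ w L f, memℓp_jointGenFun μ w L f⟩
      map_add' := by
        intro f g
        ext x
        simp only [lp.coeFn_add, Pi.add_apply, jointGenFun]
        rw [← Finset.sum_add_distrib]
        refine Finset.sum_congr rfl fun k _ => ?_
        ring
      map_smul' := by
        intro c f
        ext x
        simp only [lp.coeFn_smul, Pi.smul_apply, jointGenFun, smul_eq_mul, RingHom.id_apply]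
        rw [Finset.mul_sum]
        refine Finset.sum_congr rfl fun k _ => ?_
        ring }
    (L * (2 * |μ| + 4 * |w|))
    (fun f => lp.norm_le_of_forall_le (by positivity) fun x =>
      abs_jointGenFun_le μ w L f ‖f‖ (fun y => lp.norm_apply_le_norm ENNReal.top_ne_zero f y) x)

/-- The Markov semigroup `P_t = exp (t • generator)` of the joint process:
`(P_t f) x` is the expectation of `f` at time `t` when the process starts in `x`. -/
def jointSemigroup (μ w : ℝ) (L : ℕ) (t : ℝ) : BoundedFun L →L[ℝ] BoundedFun L :=
  NormedSpace.exp (t • jointGenerator μ w L)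

open Classical in
/-- The probability that the joint process started in `x` is in the state `y` at time `t`. -/
def transitionProb (μ w : ℝ) (L : ℕ) (t : ℝ) (x y : JointState L) : ℝ :=
  jointSemigroup μ w L t (lp.single ∞ y (1 : ℝ)) x

/-! ### The activity and its cumulants -/

/-- The moment generating function `E[exp (s A(t))]` of the activity `A(t)`, for the process started
in the configuration `η` with `A(0) = 0`. -/
def activityMGF (μ w : ℝ) (L : ℕ) (η : Config L) (s t : ℝ) : ℝ :=
  ∑' y : JointState L, Real.exp (s * y.2) * transitionProb μ w L t (η, 0) y

/-- The logarithm of the moment generating function per site and per unit time. -/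
def scaledLogMGF (μ w : ℝ) (L : ℕ) (η : Config L) (s t : ℝ) : ℝ :=
  Real.log (activityMGF μ w L η s t) / (L * t)

/-- The limiting cumulant generating function `K(L, s)` of the activity in the sector with an even
number of particles. -/
def cgf (μ w : ℝ) (L : ℕ) (s : ℝ) : ℝ :=
  limUnder atTop (fun t : ℝ => scaledLogMGF μ w L (emptyConfig L) s t)

/-- The `n`-th cumulant at the Legendre parameter `s`. -/
def cumulant (μ w : ℝ) (n L : ℕ) (s : ℝ) : ℝ := iteratedDeriv n (cgf μ w L) s

/-! ### The critical point (jump rate `w = 1/2`, deposition rate `μ = (1 - ν)/2`) -/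

/-- The jump rate. -/
def jumpRate : ℝ := 1 / 2

/-- The deposition rate in terms of `ν = 1 - μ / w`. -/
def depositionRate (ν : ℝ) : ℝ := jumpRate * (1 - ν)

/-- The critical Legendre parameter `s_c = log (1 - μ / w)`. -/
def criticalPoint (ν : ℝ) : ℝ := Real.log (1 - depositionRate ν / jumpRate)

/-- The limit per site of the cumulant generating function at the critical point. -/
def kappaStarZero (ν : ℝ) : ℝ :=
  ν / 2 - 1 + 1 / Real.pi * (Real.arcsin ν / ν + √(1 - ν ^ 2))

/-- The sound velocity. -/
def soundVelocity (ν : ℝ) : ℝ := 1 / √(1 - ν ^ 2)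

/-- The central charge of the Ising universality class. -/
def centralCharge : ℝ := 1 / 2

/-- The `r`-th term of the series that defines the scaling function. -/
def scalingTerm (u : ℝ) (r : ℕ) : ℝ :=
  √(u ^ 2 + Real.pi ^ 2 * (2 * r + 1) ^ 2) - Real.pi * (2 * r + 1)
    - u ^ 2 / (2 * Real.pi * (2 * r + 1))

/-- The universal scaling function `h`. -/
def scalingFunction (u : ℝ) : ℝ := ∑' r : ℕ, scalingTerm u r

/-- The function `K_0(L, u)`. -/
def K0 (ν : ℝ) (L : ℕ) (u : ℝ) : ℝ :=
  soundVelocity ν *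
    (cgf (depositionRate ν) jumpRate L (criticalPoint ν + u / L) - kappaStarZero ν
      - u / L * cumulant (depositionRate ν) jumpRate 1 L (criticalPoint ν)
      - u ^ 2 / (2 * L ^ 2) * cumulant (depositionRate ν) jumpRate 2 L (criticalPoint ν))

end DLPAD

end

/-! Weighting every jump by e^s replaces the generator by a matrix on configurations with deposition
rate μ and jump weight a = w e^s, and K(L, s) is its dominant eigenvalue Λ on even configurations,
divided by L. After the Jordan–Wigner transformation this matrix is, on even configurations, a
quadratic form in antiperiodic fermions (`tiltedGen_eq_quadratic`). It need not be diagonalised: one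
eigenvector suffices. On v = exp(½ Σ G d d)·vacuum annihilators act as combinations of creators
(`IsCAR.an_exp_vacuum`), so a quadratic form sends v to a multiple of v plus a pair vector, and the
latter vanishes if its coefficient matrix is symmetric. In Fourier space this symmetry is a scalar
Riccati equation for each momentum θ; its root gives Λ = Σ E(θ) − L(μ + w).

That Λ governs the growth follows from positivity of v on even configurations
(`dominantVector_pos`), obtained by deformation in s from the untilted process, where v is harmonic.
A positive eigenvector of a matrix with nonnegative entries bounds the powers of that matrix from
both sides (`exists_tiltedPower_bounds`), and uniformisation with Tonelli's theorem carries the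
bounds over to the moment generating function (`hasSum_activityMGF`).

K is now an explicit lattice sum of √A over q = θ/2, where A = 4E² depends on σ = sin² q and x = s −
s_c. At x = 0 the summand is a smooth function of q that vanishes linearly at 0 and π, and K − κ₀*
is an error of the midpoint rule: its L⁻² coefficient comes from the slopes at the end points
(`tendsto_critical_sum`) and yields πc/6. Subtracting two cumulants leaves the second-order Taylor
remainder of √A at x = u/L for each mode. For a fixed mode, L times this remainder converges to a
multiple of a term of h (`tendsto_mul_dispersionRemainder`). The third x-derivative of √A is O(1/σ)
uniformly (`exists_abs_dispersionJet_three_le`), which provides a summable majorant; dominated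
convergence gives h, with equal contributions from the modes near 0 and near π. -/

noncomputable section

namespace DLPAD

/-! ### Canonical anticommutation relations and Gaussian vectors -/

/-- The part of the canonical anticommutation relations between annihilators `c` and creators `d`
that involves at least one creator. -/
structure IsCAR {ι A : Type*} [DecidableEq ι] [Ring A] (c d : ι → A) : Prop where
  cr_cr : ∀ i j, d i * d j = -(d j * d i)
  an_cr : ∀ i j, c i * d j = (if i = j then 1 else 0) - d j * c i

/-- The quadratic creation operator `½ ∑ G i j d_i d_j`. -/
def pairCreation {ι A : Type*} [Fintype ι] [Ring A] [Algebra ℝ A] (d : ι → A)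
    (G : Matrix ι ι ℝ) : A :=
  ∑ i, ∑ j, (G i j / 2) • (d i * d j)

/-- The linear creation operator `∑ G i j d_j`. -/
def rowCreation {ι A : Type*} [Fintype ι] [Ring A] [Algebra ℝ A] (d : ι → A)
    (G : Matrix ι ι ℝ) (i : ι) : A :=
  ∑ j, G i j • d j

section Algebra

variable {ι A : Type*} [Fintype ι] [DecidableEq ι] [Ring A] [Algebra ℝ A] {c d : ι → A}

/-- Moving a creator past a product of two creators costs two signs. -/
theorem IsCAR.commute_cr_pair (h : IsCAR c d) (G : Matrix ι ι ℝ) (k : ι) :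
    Commute (d k) (pairCreation d G) := by
  refine Commute.sum_right _ _ _ fun i _ => Commute.sum_right _ _ _ fun j _ => ?_
  refine Commute.smul_right ?_ _
  have h1 : d k * d i = -(d i * d k) := h.cr_cr k i
  have h2 : d k * d j = -(d j * d k) := h.cr_cr k j
  calc d k * (d i * d j) = (d k * d i) * d j := by rw [mul_assoc]
    _ = -(d i * (d k * d j)) := by rw [h1, neg_mul, mul_assoc]
    _ = d i * d j * d k := by rw [h2]; simp [mul_assoc]

theorem IsCAR.commute_row_pair (h : IsCAR c d) (G : Matrix ι ι ℝ) (k : ι) :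
    Commute (rowCreation d G k) (pairCreation d G) :=
  Commute.sum_left _ _ _ fun j _ => (h.commute_cr_pair G j).smul_left _

/-- Either factor of d_i d_j can be contracted with c_k. Antisymmetry of `G` makes the two
contractions equal, which cancels the ½ in `pairCreation`. -/
theorem IsCAR.an_mul_pair (h : IsCAR c d) {G : Matrix ι ι ℝ} (hG : ∀ i j, G j i = -G i j)
    (k : ι) :
    c k * pairCreation d G = pairCreation d G * c k + rowCreation d G k := by
  have key : ∀ i j, c k * (d i * d j)
      = d i * d j * c k + ((if k = i then d j else 0) - (if k = j then d i else 0)) := by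
    intro i j
    rw [← mul_assoc, h.an_cr, sub_mul, mul_assoc (d i), h.an_cr k j]
    split_ifs <;> simp [mul_sub, mul_assoc] <;> abel
  simp only [pairCreation, rowCreation, Finset.mul_sum, Finset.sum_mul, mul_smul_comm,
    smul_mul_assoc, key, smul_add, Finset.sum_add_distrib, smul_sub, Finset.sum_sub_distrib]
  congr 1
  simp only [smul_ite, smul_zero]
  rw [Finset.sum_comm]
  simp only [Finset.sum_ite_eq, Finset.mem_univ, if_true]
  rw [← Finset.sum_sub_distrib]
  refine Finset.sum_congr rfl fun j _ => ?_
  rw [hG k j, ← sub_smul]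
  congr 1
  ring

/-- The commutator of c_k with Q commutes with Q, so bracketing with c_k differentiates powers of Q.
-/
theorem IsCAR.an_mul_pair_pow (h : IsCAR c d) {G : Matrix ι ι ℝ} (hG : ∀ i j, G j i = -G i j)
    (k : ι) (n : ℕ) :
    c k * pairCreation d G ^ (n + 1) = pairCreation d G ^ (n + 1) * c k
      + ((n + 1 : ℕ) : ℝ) • (pairCreation d G ^ n * rowCreation d G k) := by
  induction n with
  | zero => simp [h.an_mul_pair hG k]
  | succ n ih =>
    have hc := (h.commute_row_pair G k).eq
    rw [pow_succ, ← mul_assoc, ih, add_mul, mul_assoc, h.an_mul_pair hG k, mul_add,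
      smul_mul_assoc, mul_assoc _ (rowCreation d G k), hc, ← mul_assoc _ _ (rowCreation d G k),
      ← pow_succ, ← mul_assoc, add_assoc]
    congr 1
    push_cast
    module

end Algebra

theorem IsCAR.an_mul_exp {ι A : Type*} [Fintype ι] [DecidableEq ι] [NormedRing A]
    [NormedAlgebra ℝ A] [CompleteSpace A] {c d : ι → A} (h : IsCAR c d) {G : Matrix ι ι ℝ}
    (hG : ∀ i j, G j i = -G i j) (k : ι) :
    c k * NormedSpace.exp (pairCreation d G)
      = NormedSpace.exp (pairCreation d G) * c k
        + rowCreation d G k * NormedSpace.exp (pairCreation d G) := by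
  let : NormedAlgebra ℚ A := NormedAlgebra.restrictScalars ℚ ℝ A
  set Q := pairCreation d G with hQ
  have hs := NormedSpace.exp_series_hasSum_exp' (𝕂 := ℝ) Q
  have h1 : HasSum (fun n : ℕ => ((n.factorial : ℝ))⁻¹ • (c k * Q ^ n))
      (c k * NormedSpace.exp Q) := by
    simpa only [mul_smul_comm] using hs.mul_left (c k)
  have h2 : HasSum (fun n : ℕ => ((n.factorial : ℝ))⁻¹ • (Q ^ n * c k))
      (NormedSpace.exp Q * c k) := by
    simpa only [smul_mul_assoc] using hs.mul_right (c k)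
  have h3 : HasSum (fun n : ℕ => ((n.factorial : ℝ))⁻¹ • (Q ^ n * rowCreation d G k))
      (NormedSpace.exp Q * rowCreation d G k) := by
    simpa only [smul_mul_assoc] using hs.mul_right (rowCreation d G k)
  have h4 := h1.sub h2
  -- The zeroth terms cancel; after the index shift the factor n + 1 from the commutator is absorbed
  -- by (n + 1)!.
  rw [← hasSum_nat_add_iff' 1] at h4
  have h5 : (fun n : ℕ => ((n + 1).factorial : ℝ)⁻¹ • (c k * Q ^ (n + 1))
      - ((n + 1).factorial : ℝ)⁻¹ • (Q ^ (n + 1) * c k))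
      = fun n : ℕ => ((n.factorial : ℝ))⁻¹ • (Q ^ n * rowCreation d G k) := by
    funext n
    rw [← smul_sub, hQ, h.an_mul_pair_pow hG k n, add_sub_cancel_left, smul_smul]
    congr 1
    rw [Nat.factorial_succ]
    push_cast
    have : (n.factorial : ℝ) ≠ 0 := by positivity
    field_simp
  rw [h5] at h4
  have h6 := h3.unique h4
  simp only [Finset.range_one, Finset.sum_singleton, pow_zero, mul_one, one_mul, sub_self,
    sub_zero] at h6
  have hc : NormedSpace.exp Q * rowCreation d G k = rowCreation d G k * NormedSpace.exp Q :=
    ((h.commute_row_pair G k).exp_right).eq.symm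
  rw [← hc, h6]
  abel

/-! ### Quadratic operators acting on a Gaussian vector -/

section Vectors

variable {ι V : Type*} [Fintype ι] [NormedAddCommGroup V] [NormedSpace ℝ V]
  {c d : ι → V →L[ℝ] V}

/-- On the Gaussian vector annihilators can be traded for creators; the eigenvalue equation uses
nothing else about it. -/
theorem IsCAR.an_exp_vacuum [DecidableEq ι] [CompleteSpace V] (h : IsCAR c d) {G : Matrix ι ι ℝ}
    (hG : ∀ i j, G j i = -G i j) {Ω : V} (hΩ : ∀ i, c i Ω = 0) (k : ι) :
    c k (NormedSpace.exp (pairCreation d G) Ω)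
      = ∑ j, G k j • d j (NormedSpace.exp (pairCreation d G) Ω) := by
  have h1 := congrArg (fun T : V →L[ℝ] V => T Ω) (h.an_mul_exp hG k)
  simp only [mul_apply_eq_comp, add_apply, hΩ, map_zero,
    zero_add] at h1
  rw [h1, rowCreation]
  simp

/-- The vector `∑ M i j d_i d_j v`. -/
def pairVector (d : ι → V →L[ℝ] V) (v : V) (M : Matrix ι ι ℝ) : V :=
  ∑ i, ∑ j, M i j • d i (d j v)

theorem pairVector_add (v : V) (M N : Matrix ι ι ℝ) :
    pairVector d v (M + N) = pairVector d v M + pairVector d v N := by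
  simp [pairVector, add_smul, Finset.sum_add_distrib]

theorem pairVector_smul (v : V) (r : ℝ) (M : Matrix ι ι ℝ) :
    pairVector d v (r • M) = r • pairVector d v M := by
  simp [pairVector, mul_smul, Finset.smul_sum]

theorem IsCAR.pairVector_eq_zero [DecidableEq ι] (h : IsCAR c d) (v : V) {M : Matrix ι ι ℝ}
    (hM : M.transpose = M) : pairVector d v M = 0 := by
  have h1 : pairVector d v M = -pairVector d v M := by
    conv_lhs => rw [pairVector, Finset.sum_comm]
    rw [pairVector, ← Finset.sum_neg_distrib]
    refine Finset.sum_congr rfl fun i _ => ?_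
    rw [← Finset.sum_neg_distrib]
    refine Finset.sum_congr rfl fun j _ => ?_
    have h2 := congrArg (fun T : V →L[ℝ] V => T v) (h.cr_cr j i)
    simp only [mul_apply_eq_comp, neg_apply] at h2
    rw [h2, smul_neg]
    congr 2
    exact congrFun (congrFun hM i) j
  have h2 : (2 : ℝ) • pairVector d v M = 0 := by
    rw [two_smul]
    nth_rewrite 1 [h1]
    simp
  simpa using h2

variable {v : V} {G : Matrix ι ι ℝ}

theorem sum_cr_an (hv : ∀ i, c i v = ∑ j, G i j • d j v) (S : Matrix ι ι ℝ) :
    ∑ i, ∑ j, S i j • d i (c j v) = pairVector d v (S * G) := by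
  simp only [pairVector, hv, map_sum, map_smul, Finset.smul_sum, Matrix.mul_apply, Finset.sum_smul,
    smul_smul]
  refine Finset.sum_congr rfl fun i _ => ?_
  rw [Finset.sum_comm]

theorem sum_cr_an_swap (hv : ∀ i, c i v = ∑ j, G i j • d j v) (S : Matrix ι ι ℝ) :
    ∑ i, ∑ j, S i j • d j (c i v) = pairVector d v (S.transpose * G) := by
  rw [Finset.sum_comm, ← sum_cr_an hv]
  rfl

/-- The inner annihilator is traded for creators and the outer one is moved through them. The
contraction that this leaves is the only source of a scalar, hence of the eigenvalue. -/
theorem IsCAR.sum_an_an [DecidableEq ι] (h : IsCAR c d) (hv : ∀ i, c i v = ∑ j, G i j • d j v)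
    (S : Matrix ι ι ℝ) :
    ∑ i, ∑ j, S i j • c j (c i v)
      = (∑ i, ∑ j, S i j * G i j) • v - pairVector d v (G.transpose * S * G) := by
  have key : ∀ i j, c j (c i v) = G i j • v - ∑ l, ∑ m, (G i l * G j m) • d l (d m v) := by
    intro i j
    rw [hv i, map_sum]
    have h1 : ∀ l, c j (G i l • d l v)
        = (if j = l then G i l • v else 0) - ∑ m, (G i l * G j m) • d l (d m v) := by
      intro l
      have h2 := congrArg (fun T : V →L[ℝ] V => T v) (h.an_cr j l)
      simp only [mul_apply_eq_comp, sub_apply] at h2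
      rw [map_smul, h2, hv j, map_sum, smul_sub, Finset.smul_sum]
      congr 1
      · split_ifs <;> simp
      · simp [smul_smul]
    simp only [h1, Finset.sum_sub_distrib, Finset.sum_ite_eq, Finset.mem_univ, if_true]
  simp only [key, smul_sub, Finset.sum_sub_distrib, smul_smul, Finset.sum_smul]
  congr 1
  simp only [pairVector, Matrix.mul_apply, Finset.sum_mul, Finset.sum_smul, Finset.smul_sum,
    smul_smul, Matrix.transpose_apply]
  calc _ = ∑ i, ∑ l, ∑ j, ∑ m, (S i j * (G i l * G j m)) • d l (d m v) :=
        Finset.sum_congr rfl fun i _ => Finset.sum_comm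
    _ = ∑ l, ∑ i, ∑ j, ∑ m, (S i j * (G i l * G j m)) • d l (d m v) := Finset.sum_comm
    _ = ∑ l, ∑ i, ∑ m, ∑ j, (S i j * (G i l * G j m)) • d l (d m v) :=
        Finset.sum_congr rfl fun l _ => Finset.sum_congr rfl fun i _ => Finset.sum_comm
    _ = ∑ l, ∑ m, ∑ i, ∑ j, (S i j * (G i l * G j m)) • d l (d m v) :=
        Finset.sum_congr rfl fun l _ => Finset.sum_comm
    _ = _ := by
        refine Finset.sum_congr rfl fun l _ => Finset.sum_congr rfl fun m _ => ?_
        rw [Finset.sum_comm]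
        refine Finset.sum_congr rfl fun i _ => Finset.sum_congr rfl fun j _ => ?_
        congr 1
        ring

end Vectors

/-- A quadratic fermionic Hamiltonian acts as a scalar on a Gaussian vector whose covariance
solves the corresponding Riccati equation. -/
theorem IsCAR.quadratic_eigenvector {ι V : Type*} [Fintype ι] [DecidableEq ι]
    [NormedAddCommGroup V] [NormedSpace ℝ V] {c d : ι → V →L[ℝ] V} {v : V} {G : Matrix ι ι ℝ}
    (h : IsCAR c d) (hv : ∀ i, c i v = ∑ j, G i j • d j v) (S : Matrix ι ι ℝ) (p q r z : ℝ)
    (hM : (p • S + r • (S * G + S.transpose * G) - q • (G.transpose * S * G) - z • G).IsSymm) :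
    ∑ i, ∑ j, S i j • (p • d i (d j v) + q • c j (c i v) + r • (d i (c j v) + d j (c i v)))
      - z • ∑ i, d i (c i v) = (q * ∑ i, ∑ j, S i j * G i j) • v := by
  have h1 : ∑ i, d i (c i v) = pairVector d v G := by
    have := sum_cr_an (d := d) hv (1 : Matrix ι ι ℝ)
    rw [one_mul] at this
    rw [← this]
    simp [Matrix.one_apply]
  -- All terms other than the contraction combine into the pair vector of this symmetric matrix,
  -- which vanishes because creators anticommute.
  have h2 := h.pairVector_eq_zero v hM
  have e1 : ∑ i, ∑ j, S i j • (p • d i (d j v) + q • c j (c i v)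
        + r • (d i (c j v) + d j (c i v)))
      = p • pairVector d v S + q • (∑ i, ∑ j, S i j • c j (c i v))
        + r • (∑ i, ∑ j, S i j • d i (c j v) + ∑ i, ∑ j, S i j • d j (c i v)) := by
    simp only [pairVector, Finset.smul_sum, ← Finset.sum_add_distrib, smul_add]
    refine Finset.sum_congr rfl fun i _ => Finset.sum_congr rfl fun j _ => ?_
    module
  rw [e1, h1, h.sum_an_an hv, sum_cr_an hv, sum_cr_an_swap hv]
  rw [sub_eq_add_neg, sub_eq_add_neg, ← neg_smul, ← neg_smul, pairVector_add, pairVector_add,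
    pairVector_add, pairVector_smul, pairVector_smul, pairVector_smul, pairVector_smul,
    pairVector_add] at h2
  rw [← sub_eq_zero]
  rw [← h2]
  module

/-! ### The Jordan–Wigner operators -/

/-- The sign `(-1)^n` of an occupation number. -/
def siteSign (b : Bool) : ℝ := if b then -1 else 1

@[simp] theorem siteSign_true : siteSign true = -1 := rfl

@[simp] theorem siteSign_false : siteSign false = 1 := rfl

theorem siteSign_mul_self (b : Bool) : siteSign b * siteSign b = 1 := by
  cases b <;> simp

section JordanWigner

set_option linter.unusedSectionVars false

variable {L : ℕ} [NeZero L]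

/-- The parity sign of a configuration. -/
def paritySign (η : Config L) : ℝ := ∏ j, siteSign (η j)

/-- The Jordan–Wigner sign: the parity of the number of particles to the left of site `i`. -/
def jwSign (i : ZMod L) (η : Config L) : ℝ :=
  ∏ j ∈ Finset.univ.filter (fun j : ZMod L => j.val < i.val), siteSign (η j)

theorem jwSign_mul_self (i : ZMod L) (η : Config L) : jwSign i η * jwSign i η = 1 := by
  rw [jwSign, ← Finset.prod_mul_distrib]
  exact Finset.prod_eq_one fun j _ => siteSign_mul_self _

theorem prod_siteSign_update (s : Finset (ZMod L)) (η : Config L) (i : ZMod L) (b : Bool)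
    (hi : i ∈ s) :
    ∏ j ∈ s, siteSign (Function.update η i b j)
      = siteSign b * siteSign (η i) * ∏ j ∈ s, siteSign (η j) := by
  rw [← Finset.mul_prod_erase s _ hi, ← Finset.mul_prod_erase s (fun j => siteSign (η j)) hi,
    Function.update_self]
  have : ∏ j ∈ s.erase i, siteSign (Function.update η i b j)
      = ∏ j ∈ s.erase i, siteSign (η j) :=
    Finset.prod_congr rfl fun j hj => by
      rw [Function.update_of_ne (Finset.ne_of_mem_erase hj)]
  rw [this]
  linear_combination (-siteSign b * ∏ j ∈ s.erase i, siteSign (η j)) * siteSign_mul_self (η i)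

theorem jwSign_update_of_lt {i j : ZMod L} (h : j.val < i.val) (η : Config L) (b : Bool) :
    jwSign i (Function.update η j b) = siteSign b * siteSign (η j) * jwSign i η :=
  prod_siteSign_update _ η j b (by simpa using h)

theorem jwSign_update_of_le {i j : ZMod L} (h : i.val ≤ j.val) (η : Config L) (b : Bool) :
    jwSign i (Function.update η j b) = jwSign i η := by
  refine Finset.prod_congr rfl fun l hl => ?_
  have hl' : l.val < i.val := by simpa using hl
  rw [Function.update_of_ne]
  rintro rfl
  omega

/-- The Jordan–Wigner creation operator at site `i`. -/
def creator (i : ZMod L) : (Config L → ℝ) →L[ℝ] (Config L → ℝ) :=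
  LinearMap.toContinuousLinearMap
    { toFun := fun f η => if η i then jwSign i η * f (Function.update η i false) else 0
      map_add' := by
        intro f g
        funext η
        simp only [Pi.add_apply]
        split_ifs <;> ring
      map_smul' := by
        intro r f
        funext η
        simp only [Pi.smul_apply, smul_eq_mul, RingHom.id_apply]
        split_ifs <;> ring }

/-- The Jordan–Wigner annihilation operator at site `i`. -/
def annihilator (i : ZMod L) : (Config L → ℝ) →L[ℝ] (Config L → ℝ) :=
  LinearMap.toContinuousLinearMap
    { toFun := fun f η => if η i then 0 else jwSign i η * f (Function.update η i true)
      map_add' := by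
        intro f g
        funext η
        simp only [Pi.add_apply]
        split_ifs <;> ring
      map_smul' := by
        intro r f
        funext η
        simp only [Pi.smul_apply, smul_eq_mul, RingHom.id_apply]
        split_ifs <;> ring }

theorem creator_apply (i : ZMod L) (f : Config L → ℝ) (η : Config L) :
    creator i f η = if η i then jwSign i η * f (Function.update η i false) else 0 := rfl

theorem annihilator_apply (i : ZMod L) (f : Config L → ℝ) (η : Config L) :
    annihilator i f η = if η i then 0 else jwSign i η * f (Function.update η i true) := rfl

/-- Of two distinct sites exactly one lies to the left of the other, so exactly one of the two
strings notices the change at the other site. This single sign is the origin of the anticommutation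
relations. -/
theorem jwSign_update_cases {i j : ZMod L} (hij : i ≠ j) (η : Config L) (b b' : Bool) :
    siteSign b * siteSign (η j) = -1 → siteSign b' * siteSign (η i) = -1 →
    jwSign i η * jwSign j (Function.update η i b')
      = -(jwSign j η * jwSign i (Function.update η j b)) := by
  intro h1 h2
  rcases lt_trichotomy i.val j.val with h | h | h
  · rw [jwSign_update_of_lt h, jwSign_update_of_le h.le, h2]
    ring
  · exact absurd (ZMod.val_injective L h) hij
  · rw [jwSign_update_of_lt h, jwSign_update_of_le h.le, h1]
    ring

theorem isCAR_jordanWigner : IsCAR (annihilator (L := L)) creator where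
  cr_cr := by
    intro i j
    ext f η
    simp only [mul_apply_eq_comp, neg_apply, Pi.neg_apply, creator_apply]
    by_cases hij : i = j
    · subst hij
      simp
    · rw [Function.update_of_ne (Ne.symm hij), Function.update_of_ne hij]
      by_cases hi : η i <;> by_cases hj : η j <;> simp only [hi, hj, if_true, if_false, mul_zero,
        neg_zero, Bool.false_eq_true]
      have := jwSign_update_cases hij η false false (by simp [hj]) (by simp [hi])
      rw [Function.update_comm hij, ← mul_assoc, this]
      ring
  an_cr := by
    intro i j
    ext f η
    simp only [mul_apply_eq_comp, sub_apply, Pi.sub_apply, creator_apply, annihilator_apply]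
    by_cases hij : i = j
    · subst hij
      simp only [Function.update_self, Function.update_idem, if_true, Bool.false_eq_true, if_false,
        one_apply_eq_self]
      by_cases hi : η i
      · simp only [hi, if_true]
        rw [← mul_assoc, jwSign_update_of_le le_rfl, jwSign_mul_self]
        rw [show Function.update η i true = η by rw [← hi, Function.update_eq_self]]
        ring
      · simp only [hi]
        rw [← mul_assoc, jwSign_update_of_le le_rfl, jwSign_mul_self]
        rw [show Function.update η i false = η by
          rw [← (Bool.not_eq_true _ ▸ hi : η i = false), Function.update_eq_self]]
        simp
    · rw [Function.update_of_ne (Ne.symm hij), Function.update_of_ne hij, if_neg hij]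
      by_cases hi : η i <;> by_cases hj : η j <;> simp only [hi, hj, if_true, if_false, mul_zero,
        sub_zero, zero_apply, Pi.zero_apply, Bool.false_eq_true]
      have := jwSign_update_cases hij η false true (by simp [hj]) (by simp [hi])
      rw [Function.update_comm hij, ← mul_assoc, this]
      ring

/-- The sign of the hop across the bond `(k, k + 1)`, for antiperiodic fermions. -/
def bondSign (k : ZMod L) : ℝ := if k.val + 1 = L then -1 else 1

theorem val_succ_of_ne {k : ZMod L} (h : k.val + 1 ≠ L) : (k + 1).val = k.val + 1 := by
  have hlt : k.val + 1 < L := lt_of_le_of_ne (ZMod.val_lt k) h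
  have : ((k.val + 1 : ℕ) : ZMod L) = k + 1 := by simp
  rw [← this, ZMod.val_natCast, Nat.mod_eq_of_lt hlt]

theorem succ_eq_zero {k : ZMod L} (h : k.val + 1 = L) : k + 1 = 0 := by
  have : ((k.val + 1 : ℕ) : ZMod L) = k + 1 := by simp
  rw [← this, h, ZMod.natCast_self]

variable [Fact (1 < L)]

theorem succ_ne (k : ZMod L) : k + 1 ≠ k := by
  simp

theorem flip_eq_update (η : Config L) (k : ZMod L) :
    flip η k = Function.update (Function.update η k (!η k)) (k + 1) (!η (k + 1)) := by
  funext j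
  unfold flip
  by_cases h1 : j = k + 1
  · subst h1
    simp
  · rw [Function.update_of_ne h1]
    by_cases h2 : j = k
    · subst h2
      simp
    · rw [Function.update_of_ne h2]
      simp [h1, h2]

theorem jwSign_succ {k : ZMod L} (h : k.val + 1 ≠ L) (η : Config L) :
    jwSign (k + 1) η = siteSign (η k) * jwSign k η := by
  have : Finset.univ.filter (fun j : ZMod L => j.val < (k + 1).val)
      = insert k (Finset.univ.filter (fun j : ZMod L => j.val < k.val)) := by
    ext j
    simp only [Finset.mem_filter, Finset.mem_univ, true_and, Finset.mem_insert, val_succ_of_ne h]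
    rw [Nat.lt_succ_iff_lt_or_eq, or_comm, (ZMod.val_injective L).eq_iff]
  rw [jwSign, this, Finset.prod_insert (by simp), jwSign]

theorem jwSign_zero (η : Config L) : jwSign (0 : ZMod L) η = 1 := by
  simp [jwSign]

theorem paritySign_eq_last {k : ZMod L} (h : k.val + 1 = L) (η : Config L) :
    paritySign η = siteSign (η k) * jwSign k η := by
  have : (Finset.univ : Finset (ZMod L))
      = insert k (Finset.univ.filter (fun j : ZMod L => j.val < k.val)) := by
    ext j
    simp only [Finset.mem_filter, Finset.mem_univ, true_and, Finset.mem_insert, true_iff]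
    have := ZMod.val_lt j
    rw [← (ZMod.val_injective L).eq_iff]
    omega
  rw [paritySign, this, Finset.prod_insert (by simp), jwSign]

/-- The signed product of the Jordan–Wigner signs across a bond, on an even configuration. -/
theorem bondSign_mul_jwSign (η : Config L) (hη : paritySign η = 1) (k : ZMod L) (b : Bool)
    (hb : siteSign b * siteSign (η k) = -1) :
    bondSign k * (jwSign k η * jwSign (k + 1) (Function.update η k b)) = - siteSign (η k) := by
  -- Across the wrap-around bond the string of site 0 is empty, and even total parity makes the
  -- string of the last site equal to that site's own sign. The minus sign of `bondSign` then
  -- restores the bulk formula: even configurations need antiperiodic fermions.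
  by_cases h : k.val + 1 = L
  · have h1 := paritySign_eq_last h η
    rw [hη] at h1
    rw [succ_eq_zero h, jwSign_zero, bondSign, if_pos h]
    linear_combination siteSign (η k) * h1 + jwSign k η * siteSign_mul_self (η k)
  · rw [bondSign, if_neg h, jwSign_succ h, Function.update_self, jwSign_update_of_le le_rfl]
    linear_combination siteSign b * jwSign_mul_self k η + siteSign (η k) * hb
      - siteSign b * siteSign_mul_self (η k)

/-- On even configurations the quadratic fermionic bond term flips the bond, with a rate that
depends on the occupation of its sites. -/
theorem bond_apply (p q r : ℝ) (f : Config L → ℝ) (η : Config L) (hη : paritySign η = 1)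
    (k : ZMod L) :
    bondSign k * (p * creator k (creator (k + 1) f) η + q * annihilator (k + 1) (annihilator k f) η
      + r * (creator k (annihilator (k + 1) f) η + creator (k + 1) (annihilator k f) η))
      = (if η k then (if η (k + 1) then p else r) else (if η (k + 1) then r else q))
        * f (flip η k) := by
  have hne := succ_ne k
  have hsw := fun b b' => jwSign_update_cases hne.symm η b b'
  have hbs := bondSign_mul_jwSign η hη k
  rw [flip_eq_update]
  simp only [creator_apply, annihilator_apply, Function.update_of_ne hne,
    Function.update_of_ne hne.symm]
  by_cases hi : η k <;> by_cases hj : η (k + 1) <;> simp only [hi, hj, if_true, if_false, mul_zero,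
        add_zero, zero_add, Bool.false_eq_true, Bool.not_true, Bool.not_false]
  · have h1 := hbs false (by simp [hi])
    simp only [hi, siteSign_true] at h1
    linear_combination p * f (Function.update (Function.update η k false) (k + 1) false) * h1
  · have h1 := hbs false (by simp [hi])
    simp only [hi, siteSign_true] at h1
    linear_combination r * f (Function.update (Function.update η k false) (k + 1) true) * h1
  · have h1 := hbs true (by simp [hi])
    have h2 := hsw false true (by simp [hj]) (by simp [hi])
    simp only [hi, siteSign_false] at h1
    rw [Function.update_comm hne]
    linear_combination r * f (Function.update (Function.update η k true) (k + 1) false)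
      * (bondSign k * h2 - h1)
  · have h1 := hbs true (by simp [hi])
    have h2 := hsw true true (by simp [hj]) (by simp [hi])
    simp only [hi, siteSign_false] at h1
    rw [Function.update_comm hne]
    linear_combination q * f (Function.update (Function.update η k true) (k + 1) true)
      * (bondSign k * h2 - h1)

end JordanWigner

/-! ### Antiperiodic Fourier modes -/

section Fourier

set_option linter.unusedSectionVars false

variable {L : ℕ} [NeZero L]

/-- The antiperiodic momenta `π (2 m + 1) / L`. -/
def momentum (m : ZMod L) : ℝ := Real.pi * (2 * m.val + 1) / L

/-- The phase `exp (i π k / L)`. -/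
def halfPhase (L : ℕ) (k : ℕ) : ℂ := Complex.exp (((Real.pi * k / L : ℝ) : ℂ) * Complex.I)

/-- The matrix of the normalised antiperiodic Fourier modes. -/
def fourierMatrix (L : ℕ) [NeZero L] : Matrix (ZMod L) (ZMod L) ℂ :=
  fun i m => ((√(L : ℝ) : ℝ) : ℂ)⁻¹ * (halfPhase L i.val * ZMod.stdAddChar (m * i))

/-- The phase of the mode `m` for a translation by one site. -/
def modePhase (m : ZMod L) : ℂ := Complex.exp ((momentum m : ℂ) * Complex.I)

theorem halfPhase_add (L k l : ℕ) : halfPhase L (k + l) = halfPhase L k * halfPhase L l := by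
  rw [halfPhase, halfPhase, halfPhase, ← Complex.exp_add]
  congr 1
  push_cast
  ring

theorem halfPhase_zero (L : ℕ) : halfPhase L 0 = 1 := by simp [halfPhase]

theorem halfPhase_self (L : ℕ) [NeZero L] : halfPhase L L = -1 := by
  have : (L : ℝ) ≠ 0 := Nat.cast_ne_zero.2 (NeZero.ne L)
  rw [halfPhase, mul_div_assoc, div_self this, mul_one, Complex.exp_pi_mul_I]

theorem halfPhase_mul_conj (L k : ℕ) : halfPhase L k * (starRingEnd ℂ) (halfPhase L k) = 1 := by
  rw [Complex.mul_conj, Complex.normSq_eq_norm_sq, halfPhase, Complex.norm_exp_ofReal_mul_I]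
  simp

theorem stdAddChar_eq_halfPhase (j : ZMod L) :
    (ZMod.stdAddChar j : ℂ) = halfPhase L j.val * halfPhase L j.val := by
  rw [ZMod.stdAddChar_apply, ZMod.toCircle_apply, halfPhase, ← Complex.exp_add]
  congr 1
  push_cast
  ring

theorem modePhase_eq (m : ZMod L) : modePhase m = halfPhase L 1 * ZMod.stdAddChar m := by
  rw [stdAddChar_eq_halfPhase, modePhase, halfPhase, halfPhase, ← Complex.exp_add,
    ← Complex.exp_add, momentum]
  congr 1
  push_cast
  ring

theorem fourierMatrix_mul_conjTranspose :
    fourierMatrix L * (fourierMatrix L).conjTranspose = 1 := by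
  have hL : (L : ℂ) ≠ 0 := Nat.cast_ne_zero.2 (NeZero.ne L)
  have hs : ((√(L : ℝ) : ℝ) : ℂ) * ((√(L : ℝ) : ℝ) : ℂ) = L := by
    rw [← Complex.ofReal_mul, Real.mul_self_sqrt (Nat.cast_nonneg L)]
    simp
  ext i j
  rw [Matrix.mul_apply]
  have h1 : ∀ m : ZMod L, fourierMatrix L i m * (fourierMatrix L).conjTranspose m j
      = (L : ℂ)⁻¹ * (halfPhase L i.val * (starRingEnd ℂ) (halfPhase L j.val))
        * ZMod.stdAddChar (m * (i - j)) := by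
    intro m
    rw [Matrix.conjTranspose_apply, fourierMatrix, fourierMatrix, ← hs, mul_inv, mul_sub,
      AddChar.map_sub_eq_div, ← starRingEnd_apply, map_mul (starRingEnd ℂ),
      map_mul (starRingEnd ℂ), map_inv₀, Complex.conj_ofReal,
      div_eq_mul_inv, ← AddChar.map_neg_eq_inv, AddChar.map_neg_eq_conj]
    ring
  simp only [h1]
  rw [← Finset.mul_sum, AddChar.sum_mulShift _ (ZMod.isPrimitive_stdAddChar L)]
  by_cases hij : i = j
  · subst hij
    simp only [sub_self, if_true, ZMod.card, Matrix.one_apply_eq, halfPhase_mul_conj]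
    field_simp
  · rw [if_neg (sub_ne_zero.2 hij), Matrix.one_apply_ne hij]
    simp

theorem conjTranspose_mul_fourierMatrix :
    (fourierMatrix L).conjTranspose * fourierMatrix L = 1 :=
  mul_eq_one_comm.1 fourierMatrix_mul_conjTranspose

/-- The label −1 − m has momentum 2π − θ_m, so m ↦ −1 − m is momentum reversal for antiperiodic
modes, as m ↦ −m is for periodic ones. -/
theorem conj_fourierMatrix (i m : ZMod L) :
    (starRingEnd ℂ) (fourierMatrix L i m) = fourierMatrix L i (-1 - m) := by
  rw [fourierMatrix, fourierMatrix, map_mul, map_mul, map_inv₀, Complex.conj_ofReal,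
    ← AddChar.map_neg_eq_conj, sub_mul, sub_eq_add_neg, AddChar.map_add_eq_mul, neg_one_mul]
  have h1 : (starRingEnd ℂ) (halfPhase L i.val)
      = halfPhase L i.val * ZMod.stdAddChar (-i) := by
    rw [AddChar.map_neg_eq_conj, stdAddChar_eq_halfPhase, map_mul, ← mul_assoc,
      halfPhase_mul_conj, one_mul]
  rw [h1, neg_mul_eq_neg_mul]
  ring

theorem conj_modePhase (m : ZMod L) :
    (starRingEnd ℂ) (modePhase m) = modePhase (-1 - m) := by
  rw [modePhase_eq, modePhase_eq, sub_eq_add_neg, AddChar.map_add_eq_mul, map_mul,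
    ← AddChar.map_neg_eq_conj, AddChar.map_neg_eq_conj _ (1 : ZMod L), ← mul_assoc]
  congr 1
  -- For L = 1 the representative of 1 is 0, and `stdAddChar_eq_halfPhase` does not produce the half
  -- phase of 1.
  by_cases hL : L = 1
  · subst hL
    rw [halfPhase_self, show (1 : ZMod 1) = 0 from Subsingleton.elim _ _]
    simp
  · have h1 : (1 : ZMod L).val = 1 := by
      rw [ZMod.val_one'']
      exact hL
    rw [stdAddChar_eq_halfPhase, h1, map_mul, ← mul_assoc, halfPhase_mul_conj, one_mul]

theorem modePhase_eq_cos_sin (m : ZMod L) :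
    modePhase m = (Real.cos (momentum m) : ℂ) + (Real.sin (momentum m) : ℂ) * Complex.I := by
  rw [modePhase, Complex.exp_mul_I, Complex.ofReal_cos, Complex.ofReal_sin]

theorem cos_momentum_reflect (m : ZMod L) :
    Real.cos (momentum (-1 - m)) = Real.cos (momentum m) := by
  have h := congrArg Complex.re (conj_modePhase m)
  rw [modePhase_eq_cos_sin, modePhase_eq_cos_sin] at h
  simp [-Complex.ofReal_cos, -Complex.ofReal_sin] at h
  exact h.symm

theorem sin_momentum_reflect (m : ZMod L) :
    Real.sin (momentum (-1 - m)) = -Real.sin (momentum m) := by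
  have h := congrArg Complex.im (conj_modePhase m)
  rw [modePhase_eq_cos_sin, modePhase_eq_cos_sin] at h
  simp [-Complex.ofReal_cos, -Complex.ofReal_sin] at h
  exact h.symm

/-- Antiperiodic momenta lie strictly between 0 and 2π. Avoiding θ = 0 keeps every radicand positive
on a finite lattice, even at the critical point. -/
theorem cos_momentum_lt_one (m : ZMod L) : Real.cos (momentum m) < 1 := by
  have hL : (0 : ℝ) < L := Nat.cast_pos.2 (NeZero.pos L)
  have hv : (m.val : ℝ) + 1 ≤ L := by exact_mod_cast ZMod.val_lt m
  have hpos : 0 < momentum m := by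
    have := Real.pi_pos
    unfold momentum
    positivity
  have hlt : momentum m < 2 * Real.pi := by
    rw [momentum, div_lt_iff₀ hL]
    nlinarith [Real.pi_pos]
  refine lt_of_le_of_ne (Real.cos_le_one _) fun h => ?_
  have := (Real.cos_eq_one_iff_of_lt_of_lt (by linarith) hlt).1 h
  linarith

theorem sum_cos_momentum (hL : 1 < L) : ∑ m : ZMod L, Real.cos (momentum m) = 0 := by
  have : Fact (1 < L) := ⟨hL⟩
  have h1 : ∑ m : ZMod L, modePhase m = 0 := by
    simp only [modePhase_eq]
    rw [← Finset.mul_sum]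
    have h2 := AddChar.sum_mulShift (1 : ZMod L) (ZMod.isPrimitive_stdAddChar L)
    simp only [mul_one, one_ne_zero, if_false, Nat.cast_zero] at h2
    rw [h2, mul_zero]
  have h3 := congrArg Complex.re h1
  rw [Complex.re_sum] at h3
  simpa [modePhase_eq_cos_sin, -Complex.ofReal_cos, -Complex.ofReal_sin] using h3

/-- The matrix with eigenvalues `f m` on the antiperiodic Fourier modes. -/
def spectralMatrix (f : ZMod L → ℂ) : Matrix (ZMod L) (ZMod L) ℂ :=
  fourierMatrix L * Matrix.diagonal f * (fourierMatrix L).conjTranspose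

theorem spectralMatrix_apply (f : ZMod L → ℂ) (i j : ZMod L) :
    spectralMatrix f i j
      = ∑ m, f m * (fourierMatrix L i m * (starRingEnd ℂ) (fourierMatrix L j m)) := by
  rw [spectralMatrix, Matrix.mul_apply]
  refine Finset.sum_congr rfl fun m _ => ?_
  rw [Matrix.mul_diagonal, Matrix.conjTranspose_apply, starRingEnd_apply]
  ring

theorem spectralMatrix_mul (f g : ZMod L → ℂ) :
    spectralMatrix f * spectralMatrix g = spectralMatrix (f * g) := by
  rw [spectralMatrix, spectralMatrix, spectralMatrix]
  calc _ = fourierMatrix L * Matrix.diagonal f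
        * ((fourierMatrix L).conjTranspose * fourierMatrix L) * Matrix.diagonal g
        * (fourierMatrix L).conjTranspose := by simp only [Matrix.mul_assoc]
    _ = _ := by
      rw [conjTranspose_mul_fourierMatrix, Matrix.mul_one, Matrix.mul_assoc (fourierMatrix L),
        Matrix.diagonal_mul_diagonal]
      rfl

theorem spectralMatrix_add (f g : ZMod L → ℂ) :
    spectralMatrix (f + g) = spectralMatrix f + spectralMatrix g := by
  ext i j
  simp only [spectralMatrix_apply, Matrix.add_apply, Pi.add_apply, add_mul, Finset.sum_add_distrib]

theorem spectralMatrix_smul (r : ℂ) (f : ZMod L → ℂ) :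
    spectralMatrix (r • f) = r • spectralMatrix f := by
  ext i j
  simp only [spectralMatrix_apply, Matrix.smul_apply, Pi.smul_apply, smul_eq_mul, mul_assoc,
    Finset.mul_sum]

theorem spectralMatrix_transpose (f : ZMod L → ℂ) :
    (spectralMatrix f).transpose = spectralMatrix fun m => f (-1 - m) := by
  ext i j
  rw [Matrix.transpose_apply, spectralMatrix_apply, spectralMatrix_apply,
    ← (Equiv.subLeft (-1 : ZMod L)).sum_comp]
  refine Finset.sum_congr rfl fun m _ => ?_
  simp only [Equiv.subLeft_apply]
  rw [← conj_fourierMatrix j m, ← conj_fourierMatrix i m, Complex.conj_conj]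
  ring

theorem conj_spectralMatrix_apply (f : ZMod L → ℂ) (i j : ZMod L) :
    (starRingEnd ℂ) (spectralMatrix f i j)
      = spectralMatrix (fun m => (starRingEnd ℂ) (f (-1 - m))) i j := by
  rw [spectralMatrix_apply, spectralMatrix_apply, map_sum,
    ← (Equiv.subLeft (-1 : ZMod L)).sum_comp]
  refine Finset.sum_congr rfl fun m _ => ?_
  simp only [Equiv.subLeft_apply]
  rw [map_mul, map_mul, ← conj_fourierMatrix j m, ← conj_fourierMatrix i m, Complex.conj_conj,
    Complex.conj_conj]

theorem trace_spectralMatrix (f : ZMod L → ℂ) :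
    (spectralMatrix f).trace = ∑ m, f m := by
  rw [spectralMatrix, Matrix.trace_mul_comm, ← Matrix.mul_assoc, conjTranspose_mul_fourierMatrix,
    Matrix.one_mul, Matrix.trace_diagonal]

/-- The antiperiodic translation matrix. -/
def shiftMatrix (L : ℕ) [NeZero L] : Matrix (ZMod L) (ZMod L) ℝ :=
  fun i j => if j = i + 1 then bondSign i else 0

/-- A shift by one site multiplies a mode by its phase; the half phase at L is −1, which matches
`bondSign` at the last site. -/
theorem shiftMatrix_map :
    (shiftMatrix L).map (fun x : ℝ => (x : ℂ)) = spectralMatrix modePhase := by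
  have h : (shiftMatrix L).map (fun x : ℝ => (x : ℂ)) * fourierMatrix L
      = fourierMatrix L * Matrix.diagonal modePhase := by
    ext i m
    rw [Matrix.mul_apply, Matrix.mul_diagonal]
    simp only [Matrix.map_apply, shiftMatrix]
    rw [Finset.sum_eq_single (i + 1) (fun j _ hj => by simp [hj]) (by simp), if_pos rfl,
      modePhase_eq, fourierMatrix, fourierMatrix, mul_add, mul_one, AddChar.map_add_eq_mul]
    by_cases hi : i.val + 1 = L
    · have h1 : halfPhase L i.val * halfPhase L 1 = -1 := by
        rw [← halfPhase_add, hi, halfPhase_self]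
      rw [bondSign, if_pos hi, succ_eq_zero hi, ZMod.val_zero, halfPhase_zero]
      push_cast
      linear_combination (-((√(L : ℝ) : ℝ) : ℂ)⁻¹ * ZMod.stdAddChar (m * i)
        * ZMod.stdAddChar m) * h1
    · rw [bondSign, if_neg hi, val_succ_of_ne hi, halfPhase_add]
      push_cast
      ring
  rw [spectralMatrix, ← h, Matrix.mul_assoc, fourierMatrix_mul_conjTranspose, Matrix.mul_one]

/-- The real antisymmetric matrix with eigenvalues `i γ m` on the antiperiodic Fourier modes. -/
def covarianceMatrix (γ : ZMod L → ℝ) : Matrix (ZMod L) (ZMod L) ℝ := fun i j =>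
  ∑ m, γ m * (Complex.I * (fourierMatrix L i m * (starRingEnd ℂ) (fourierMatrix L j m))).re

/-- Since `γ` is odd under momentum reversal, the matrix with eigenvalues iγ equals its complex
conjugate, and the real parts in `covarianceMatrix` lose nothing. -/
theorem covarianceMatrix_map {γ : ZMod L → ℝ} (hγ : ∀ m, γ (-1 - m) = -γ m) :
    (covarianceMatrix γ).map (fun x : ℝ => (x : ℂ))
      = spectralMatrix fun m => Complex.I * γ m := by
  ext i j
  have h1 : covarianceMatrix γ i j = (spectralMatrix (fun m => Complex.I * γ m) i j).re := by
    rw [spectralMatrix_apply, Complex.re_sum, covarianceMatrix]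
    refine Finset.sum_congr rfl fun m _ => ?_
    rw [← Complex.re_ofReal_mul]
    congr 1
    ring
  rw [Matrix.map_apply, h1]
  apply Complex.conj_eq_iff_re.1
  rw [conj_spectralMatrix_apply]
  congr 1
  funext m
  simp [hγ]

theorem covarianceMatrix_antisymm {γ : ZMod L → ℝ} (hγ : ∀ m, γ (-1 - m) = -γ m)
    (i j : ZMod L) : covarianceMatrix γ j i = -covarianceMatrix γ i j := by
  have h := spectralMatrix_transpose fun m : ZMod L => Complex.I * (γ m : ℂ)
  have h2 : (fun m : ZMod L => Complex.I * ((γ (-1 - m) : ℝ) : ℂ))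
      = (-1 : ℂ) • fun m : ZMod L => Complex.I * ((γ m : ℝ) : ℂ) := by
    funext m
    simp [hγ]
  rw [h2, spectralMatrix_smul, ← covarianceMatrix_map hγ] at h
  have h3 := congrFun (congrFun h i) j
  simp only [Matrix.transpose_apply, Matrix.map_apply, Matrix.smul_apply, smul_eq_mul,
    neg_mul, one_mul] at h3
  exact_mod_cast h3

/-- All matrices are diagonal in the Fourier modes, so symmetry means that the eigenvalue is even in
the momentum. That eigenvalue is (p − qγ²) cos θ, which is even, plus i times the left side of the
Riccati equation, which is odd. -/
theorem isSymm_of_riccati {γ : ZMod L → ℝ} (hγ : ∀ m, γ (-1 - m) = -γ m) {p q r z : ℝ}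
    (h : ∀ m, p * Real.sin (momentum m) + (2 * r * Real.cos (momentum m) - z) * γ m
      - q * Real.sin (momentum m) * γ m ^ 2 = 0) :
    (p • shiftMatrix L + r • (shiftMatrix L * covarianceMatrix γ
        + (shiftMatrix L).transpose * covarianceMatrix γ)
      - q • ((covarianceMatrix γ).transpose * shiftMatrix L * covarianceMatrix γ)
      - z • covarianceMatrix γ).IsSymm := by
  set S := shiftMatrix L with hS
  set G := covarianceMatrix γ with hG
  have hGt : G.transpose = -G := by
    ext i j
    exact covarianceMatrix_antisymm hγ i j
  set φ : ℝ →+* ℂ := Complex.ofRealHom with hφ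
  have hSm : S.map φ = spectralMatrix modePhase := shiftMatrix_map
  have hGm : G.map φ = spectralMatrix fun m => Complex.I * γ m := covarianceMatrix_map hγ
  set M := p • S + r • (S * G + S.transpose * G) - q • (G.transpose * S * G) - z • G with hM
  set g : ZMod L → ℂ := fun m =>
    (((p - q * γ m ^ 2) * Real.cos (momentum m) : ℝ) : ℂ) with hg
  have hMm : M.map φ = spectralMatrix g := by
    have e0 : g = (p : ℂ) • modePhase + (r : ℂ) • (modePhase * (fun m => Complex.I * γ m)
        + (fun m => modePhase (-1 - m)) * (fun m => Complex.I * γ m))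
        + (q : ℂ) • ((fun m => Complex.I * γ m) * modePhase * (fun m => Complex.I * γ m))
        + (-z : ℂ) • (fun m => Complex.I * γ m) := by
      funext m
      have hm : ((p * Real.sin (momentum m) + (2 * r * Real.cos (momentum m) - z) * γ m
        - q * Real.sin (momentum m) * γ m ^ 2 : ℝ) : ℂ) = 0 := by rw [h m]; simp
      push_cast at hm
      simp only [hg, Pi.add_apply, Pi.smul_apply, Pi.mul_apply, smul_eq_mul, modePhase_eq_cos_sin,
        cos_momentum_reflect, sin_momentum_reflect]
      push_cast
      linear_combination (-Complex.I) * hm - (q * γ m ^ 2 * (Complex.cos (momentum m)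
        + Complex.sin (momentum m) * Complex.I)) * Complex.I_sq
    rw [e0, spectralMatrix_add, spectralMatrix_add, spectralMatrix_add, spectralMatrix_smul,
      spectralMatrix_smul, spectralMatrix_smul, spectralMatrix_smul, spectralMatrix_add,
      ← spectralMatrix_mul, ← spectralMatrix_mul, ← spectralMatrix_mul, ← spectralMatrix_mul,
      ← spectralMatrix_transpose, ← hSm, ← hGm, ← Matrix.transpose_map, ← Matrix.map_mul,
      ← Matrix.map_mul, ← Matrix.map_mul, ← Matrix.map_mul, hM, hGt]
    ext i j
    simp only [Matrix.map_apply, Matrix.add_apply, Matrix.sub_apply, Matrix.smul_apply, smul_eq_mul,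
      map_add, map_sub, map_mul, map_neg, Matrix.neg_mul, Matrix.neg_apply, hφ,
      Complex.ofRealHom_eq_coe]
    ring
  have hsym : (spectralMatrix g).transpose = spectralMatrix g := by
    rw [spectralMatrix_transpose]
    congr 1
    funext m
    simp only [hg, cos_momentum_reflect, hγ, neg_sq]
  have hinj : Function.Injective (fun N : Matrix (ZMod L) (ZMod L) ℝ => N.map φ) :=
    Matrix.map_injective Complex.ofReal_injective
  refine hinj ?_
  simp only
  rw [Matrix.transpose_map, hMm, hsym]

/-- Antisymmetry turns the sum into minus a trace, and the trace is the sum of iγ e^{iθ} over the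
modes. -/
theorem sum_shift_mul_covariance {γ : ZMod L → ℝ} (hγ : ∀ m, γ (-1 - m) = -γ m) :
    ∑ i, ∑ j, shiftMatrix L i j * covarianceMatrix γ i j
      = ∑ m : ZMod L, γ m * Real.sin (momentum m) := by
  have h1 : ∑ i, ∑ j, shiftMatrix L i j * covarianceMatrix γ i j
      = -(shiftMatrix L * covarianceMatrix γ).trace := by
    simp only [Matrix.trace, Matrix.diag_apply, Matrix.mul_apply, ← Finset.sum_neg_distrib]
    refine Finset.sum_congr rfl fun i _ => Finset.sum_congr rfl fun j _ => ?_
    rw [covarianceMatrix_antisymm hγ i j]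
    ring
  set φ : ℝ →+* ℂ := Complex.ofRealHom with hφ
  have hSm : (shiftMatrix L).map φ = spectralMatrix modePhase := shiftMatrix_map
  have hGm : (covarianceMatrix γ).map φ = spectralMatrix fun m => Complex.I * γ m :=
    covarianceMatrix_map hγ
  have h2 : (((shiftMatrix L * covarianceMatrix γ).trace : ℝ) : ℂ)
      = ∑ m : ZMod L, modePhase m * (Complex.I * γ m) := by
    have h3 := trace_spectralMatrix (modePhase * fun m : ZMod L => Complex.I * (γ m : ℂ))
    rw [← spectralMatrix_mul, ← hSm, ← hGm, ← Matrix.map_mul] at h3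
    rw [Pi.mul_def] at h3
    rw [← h3]
    simp only [Matrix.trace, Matrix.diag_apply, Matrix.map_apply, Complex.ofReal_sum]
    rfl
  have h4 := congrArg Complex.re h2
  rw [Complex.ofReal_re, Complex.re_sum] at h4
  rw [h1, h4, ← Finset.sum_neg_distrib]
  refine Finset.sum_congr rfl fun m _ => ?_
  rw [modePhase, Complex.exp_mul_I, ← Complex.ofReal_cos, ← Complex.ofReal_sin]
  simp [-Complex.ofReal_cos, -Complex.ofReal_sin]
  ring

end Fourier

/-! ### The tilted generator and its Gaussian eigenvector -/

/-- The generator on configurations in which particle jumps are weighted by `a / w`. -/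
def tiltedGen (μ w a : ℝ) {L : ℕ} (f : Config L → ℝ) (η : Config L) : ℝ :=
  ∑ k ∈ Finset.range L,
    ((μ + a * (occ η (k : ZMod L) + occ η ((k : ZMod L) + 1))) * f (flip η k)
      - (μ + w * (occ η (k : ZMod L) + occ η ((k : ZMod L) + 1))) * f η)

/-- The diagonal part of the Bogoliubov–de Gennes Hamiltonian at momentum `θ`. -/
def kineticEnergy (μ w a θ : ℝ) : ℝ := (μ + a) * Real.cos θ - w

/-- The quasi-particle energy at momentum `θ`. -/
def quasiEnergy (μ w a θ : ℝ) : ℝ :=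
  √(kineticEnergy μ w a θ ^ 2 + μ * (μ + 2 * a) * Real.sin θ ^ 2)

/-- The pair amplitude at momentum `θ` of the dominant eigenvector. -/
def pairAmplitude (μ w a θ : ℝ) : ℝ :=
  (μ + 2 * a) * Real.sin θ / (quasiEnergy μ w a θ - kineticEnergy μ w a θ)

/-! ### Single-mode algebra: quasi-particle energy and Riccati root -/

section Energies

variable {μ w a θ : ℝ}

/-- Only sin θ = 0 needs an argument: then cos θ = −1 and the kinetic energy is −(μ + a + w). -/
theorem quasiEnergy_radicand_pos (hμ : 0 < μ) (hw : 0 < w) (ha : 0 < a) (hθ : Real.cos θ < 1) :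
    0 < kineticEnergy μ w a θ ^ 2 + μ * (μ + 2 * a) * Real.sin θ ^ 2 := by
  by_cases hs : Real.sin θ = 0
  · have hc : Real.cos θ = -1 := by
      rcases Real.sin_eq_zero_iff_cos_eq.1 hs with h | h
      · linarith
      · exact h
    have : kineticEnergy μ w a θ < 0 := by
      rw [kineticEnergy, hc]
      linarith
    rw [hs]
    nlinarith
  · positivity

theorem kineticEnergy_lt_quasiEnergy (hμ : 0 < μ) (hw : 0 < w) (ha : 0 < a)
    (hθ : Real.cos θ < 1) : kineticEnergy μ w a θ < quasiEnergy μ w a θ := by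
  by_cases hs : Real.sin θ = 0
  · have hc : Real.cos θ = -1 := by
      rcases Real.sin_eq_zero_iff_cos_eq.1 hs with h | h
      · linarith
      · exact h
    have : kineticEnergy μ w a θ < 0 := by
      rw [kineticEnergy, hc]
      linarith
    exact this.trans_le (Real.sqrt_nonneg _)
  · refine Real.lt_sqrt_of_sq_lt ?_
    have : 0 < μ * (μ + 2 * a) * Real.sin θ ^ 2 := by positivity
    linarith

theorem quasiEnergy_sq (hμ : 0 < μ) (ha : 0 < a) : quasiEnergy μ w a θ ^ 2
    = kineticEnergy μ w a θ ^ 2 + μ * (μ + 2 * a) * Real.sin θ ^ 2 :=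
  Real.sq_sqrt (by positivity)

/-- This and `mul_pairAmplitude` both reduce to E² − e² = μ(μ + 2a) sin² θ, with e the kinetic
energy. The root with denominator E − e, which is positive, is the one that contributes +E to the
eigenvalue in every mode. -/
theorem pairAmplitude_riccati (hμ : 0 < μ) (hw : 0 < w) (ha : 0 < a) (hθ : Real.cos θ < 1) :
    (μ + 2 * a) * Real.sin θ + (2 * (μ + a) * Real.cos θ - 2 * w) * pairAmplitude μ w a θ
      - μ * Real.sin θ * pairAmplitude μ w a θ ^ 2 = 0 := by
  have h1 := sub_pos.2 (kineticEnergy_lt_quasiEnergy hμ hw ha hθ)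
  have h2 := quasiEnergy_sq (w := w) (θ := θ) hμ ha
  have h3 : 2 * (μ + a) * Real.cos θ - 2 * w = 2 * kineticEnergy μ w a θ := by
    rw [kineticEnergy]
    ring
  rw [h3, pairAmplitude]
  set e := kineticEnergy μ w a θ
  set E := quasiEnergy μ w a θ
  field_simp
  linear_combination (μ + 2 * a) * Real.sin θ * h2

theorem mul_pairAmplitude (hμ : 0 < μ) (hw : 0 < w) (ha : 0 < a) (hθ : Real.cos θ < 1) :
    μ * (pairAmplitude μ w a θ * Real.sin θ) = kineticEnergy μ w a θ + quasiEnergy μ w a θ := by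
  have h1 := sub_pos.2 (kineticEnergy_lt_quasiEnergy hμ hw ha hθ)
  have h2 := quasiEnergy_sq (w := w) (θ := θ) hμ ha
  rw [pairAmplitude]
  set e := kineticEnergy μ w a θ
  set E := quasiEnergy μ w a θ
  field_simp
  linear_combination -h2

end Energies

theorem sum_range_natCast_zmod {M : Type*} [AddCommMonoid M] (L : ℕ) [NeZero L] (f : ZMod L → M) :
    ∑ k ∈ Finset.range L, f (k : ZMod L) = ∑ k : ZMod L, f k := by
  refine Finset.sum_bij' (fun k _ => (k : ZMod L)) (fun k _ => k.val) ?_ ?_ ?_ ?_ ?_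
  · simp
  · intro k _
    simpa using ZMod.val_lt k
  · intro k hk
    exact ZMod.val_cast_of_lt (Finset.mem_range.1 hk)
  · simp
  · simp

/-! ### The tilted generator as a quadratic form, and its Gaussian eigenvector -/

section Eigenvector

set_option linter.unusedSectionVars false

variable {L : ℕ} [NeZero L]

/-- The Gaussian vector with antiperiodic pair amplitudes `γ`, normalised to be `1` on the empty
configuration. -/
def gaussianVector (γ : ZMod L → ℝ) : Config L → ℝ :=
  NormedSpace.exp (pairCreation creator (covarianceMatrix γ)) (Pi.single (emptyConfig L) 1)

theorem annihilator_vacuum (i : ZMod L) :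
    annihilator i (Pi.single (emptyConfig L) (1 : ℝ)) = 0 := by
  funext η
  rw [annihilator_apply, Pi.zero_apply]
  split_ifs with h
  · rfl
  · rw [Pi.single_eq_of_ne, mul_zero]
    intro h2
    have := congrFun h2 i
    simp [emptyConfig] at this

theorem annihilator_gaussianVector {γ : ZMod L → ℝ} (hγ : ∀ m, γ (-1 - m) = -γ m) (i : ZMod L) :
    annihilator i (gaussianVector γ)
      = ∑ j, covarianceMatrix γ i j • creator j (gaussianVector γ) :=
  isCAR_jordanWigner.an_exp_vacuum (covarianceMatrix_antisymm hγ) annihilator_vacuum i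

/-- Functions in the range of pair creation vanish on the empty configuration, so only the zeroth
term of the exponential contributes. -/
theorem gaussianVector_emptyConfig (γ : ZMod L → ℝ) : gaussianVector γ (emptyConfig L) = 1 := by
  let : NormedAlgebra ℚ ((Config L → ℝ) →L[ℝ] (Config L → ℝ)) :=
    NormedAlgebra.restrictScalars ℚ ℝ _
  set Q : (Config L → ℝ) →L[ℝ] (Config L → ℝ) :=
    pairCreation creator (covarianceMatrix γ) with hQ
  have hs := NormedSpace.exp_series_hasSum_exp' (𝕂 := ℝ) Q
  let ev : ((Config L → ℝ) →L[ℝ] (Config L → ℝ)) →L[ℝ] ℝ :=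
    (ContinuousLinearMap.proj (R := ℝ) (φ := fun _ : Config L => ℝ) (emptyConfig L)).comp
      (ContinuousLinearMap.apply ℝ (Config L → ℝ) (Pi.single (emptyConfig L) (1 : ℝ)))
  have h0 : ∀ f : Config L → ℝ, Q f (emptyConfig L) = 0 := by
    intro f
    simp [hQ, pairCreation, creator_apply, emptyConfig]
  have h1 := hs.mapL ev
  have h2 : HasSum (fun n : ℕ => ev (((n.factorial : ℝ))⁻¹ • Q ^ n)) 1 := by
    have : (1 : ℝ) = ev ((((0 : ℕ).factorial : ℝ))⁻¹ • Q ^ 0) := by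
      simp [ev]
    rw [this]
    refine hasSum_single 0 fun n hn => ?_
    obtain ⟨n, rfl⟩ := Nat.exists_eq_succ_of_ne_zero hn
    rw [pow_succ']
    simp [ev, h0]
  exact h1.unique h2

theorem number_apply (f : Config L → ℝ) (η : Config L) (i : ZMod L) :
    creator i (annihilator i f) η = occ η i * f η := by
  rw [creator_apply, annihilator_apply, occ]
  by_cases hi : η i
  · simp only [hi, if_true, Function.update_self, Bool.false_eq_true, if_false,
      Function.update_idem]
    rw [← mul_assoc, jwSign_update_of_le le_rfl, jwSign_mul_self, ← hi, Function.update_eq_self]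
  · simp [hi]

variable [Fact (1 < L)]

/-- The generator acts on functions, so occupations are those of `η` before the flip: two creators
carry the rate for two occupied sites, two annihilators the rate for two empty ones, mixed products
the rate for one particle. Each particle touches two bonds, whence 2w per particle in the escape
rate. -/
theorem tiltedGen_eq_quadratic (μ w a : ℝ) (f : Config L → ℝ) (η : Config L)
    (hη : paritySign η = 1) :
    tiltedGen μ w a f η
      = (∑ i, ∑ j, shiftMatrix L i j • ((μ + 2 * a) • creator i (creator j f)
          + μ • annihilator j (annihilator i f)
          + (μ + a) • (creator i (annihilator j f) + creator j (annihilator i f)))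
        - (2 * w) • ∑ i, creator i (annihilator i f)) η - L * μ * f η := by
  rw [tiltedGen, sum_range_natCast_zmod L fun k : ZMod L =>
    ((μ + a * (occ η k + occ η (k + 1))) * f (flip η k)
      - (μ + w * (occ η k + occ η (k + 1))) * f η)]
  have h1 : ∀ i : ZMod L, ∑ j, shiftMatrix L i j • ((μ + 2 * a) • creator i (creator j f)
          + μ • annihilator j (annihilator i f)
          + (μ + a) • (creator i (annihilator j f) + creator j (annihilator i f)))
      = bondSign i • ((μ + 2 * a) • creator i (creator (i + 1) f)
          + μ • annihilator (i + 1) (annihilator i f)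
          + (μ + a) • (creator i (annihilator (i + 1) f) + creator (i + 1) (annihilator i f))) := by
    intro i
    rw [Finset.sum_eq_single (i + 1)]
    · simp [shiftMatrix]
    · intro j _ hj
      simp [shiftMatrix, hj]
    · simp
  simp only [h1]
  rw [Pi.sub_apply, Pi.smul_apply, Finset.sum_apply, Finset.sum_apply]
  have h2 : ∀ i : ZMod L, (bondSign i • ((μ + 2 * a) • creator i (creator (i + 1) f)
          + μ • annihilator (i + 1) (annihilator i f)
          + (μ + a) • (creator i (annihilator (i + 1) f) + creator (i + 1) (annihilator i f)))) η
      = (μ + a * (occ η i + occ η (i + 1))) * f (flip η i) := by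
    intro i
    simp only [Pi.smul_apply, Pi.add_apply, smul_eq_mul]
    rw [bond_apply _ _ _ _ _ hη]
    congr 1
    unfold occ
    split_ifs <;> ring
  simp only [h2, number_apply, Finset.sum_sub_distrib, smul_eq_mul, ← Finset.sum_mul]
  have h3 : ∑ k : ZMod L, (μ + w * (occ η k + occ η (k + 1)))
      = L * μ + 2 * w * ∑ k, occ η k := by
    have h4 : ∑ k : ZMod L, occ η (k + 1) = ∑ k, occ η k :=
      Equiv.sum_comp (Equiv.addRight (1 : ZMod L)) fun k => occ η k
    rw [Finset.sum_add_distrib, ← Finset.mul_sum, Finset.sum_add_distrib, h4]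
    simp
    ring
  rw [h3]
  ring

/-- The dominant eigenvalue of the tilted generator on even configurations. -/
def dominantEigenvalue (L : ℕ) [NeZero L] (μ w a : ℝ) : ℝ :=
  ∑ m : ZMod L, quasiEnergy μ w a (momentum m) - L * (μ + w)

/-- The dominant eigenvector of the tilted generator on even configurations. -/
def dominantVector (L : ℕ) [NeZero L] (μ w a : ℝ) : Config L → ℝ :=
  gaussianVector fun m : ZMod L => pairAmplitude μ w a (momentum m)

theorem pairAmplitude_reflect (μ w a : ℝ) (m : ZMod L) :
    pairAmplitude μ w a (momentum (-1 - m)) = -pairAmplitude μ w a (momentum m) := by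
  simp only [pairAmplitude, quasiEnergy, kineticEnergy, cos_momentum_reflect,
    sin_momentum_reflect, neg_sq]
  ring

theorem tiltedGen_dominantVector {μ w a : ℝ} (hμ : 0 < μ) (hw : 0 < w) (ha : 0 < a)
    (η : Config L) (hη : paritySign η = 1) :
    tiltedGen μ w a (dominantVector L μ w a) η
      = dominantEigenvalue L μ w a * dominantVector L μ w a η := by
  set γ : ZMod L → ℝ := fun m => pairAmplitude μ w a (momentum m) with hγdef
  have hγ : ∀ m, γ (-1 - m) = -γ m := pairAmplitude_reflect μ w a
  have hsym := isSymm_of_riccati (p := μ + 2 * a) (q := μ) (r := μ + a) (z := 2 * w) hγ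
    fun m => by
      have := pairAmplitude_riccati hμ hw ha (cos_momentum_lt_one m)
      simpa [hγdef] using this
  have h := isCAR_jordanWigner.quadratic_eigenvector (annihilator_gaussianVector hγ)
    (shiftMatrix L) _ _ _ _ hsym
  -- The scalar is Σ (e + E) over the modes. The cosines in e sum to zero and leave −w per mode.
  have h1 : μ * ∑ i, ∑ j, shiftMatrix L i j * covarianceMatrix γ i j
      = dominantEigenvalue L μ w a + L * μ := by
    rw [sum_shift_mul_covariance hγ, Finset.mul_sum]
    simp only [hγdef]
    rw [Finset.sum_congr rfl fun m _ => mul_pairAmplitude hμ hw ha (cos_momentum_lt_one m),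
      Finset.sum_add_distrib, dominantEigenvalue]
    simp only [kineticEnergy]
    rw [Finset.sum_sub_distrib, ← Finset.mul_sum, sum_cos_momentum Fact.out]
    simp
    ring
  rw [tiltedGen_eq_quadratic _ _ _ _ _ hη]
  change (_ : Config L → ℝ) η - L * μ * gaussianVector γ η = _ * gaussianVector γ η
  rw [dominantVector, h, h1, Pi.smul_apply, smul_eq_mul]
  ring

end Eigenvector

/-! ### Positivity of the dominant eigenvector -/

section Positivity

set_option linter.unusedSectionVars false

variable {L : ℕ} [NeZero L]

theorem paritySign_of_even {η : Config L} (h : Even (particleNumber η)) : paritySign η = 1 := by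
  have h1 : particleNumber η = ∑ k : ZMod L, if η k then 1 else 0 :=
    sum_range_natCast_zmod L fun k => if η k then 1 else 0
  have h2 : paritySign η = (-1) ^ particleNumber η := by
    rw [h1, ← Finset.prod_pow_eq_pow_sum, paritySign]
    refine Finset.prod_congr rfl fun k _ => ?_
    by_cases hk : η k <;> simp [hk]
  rw [h2, h.neg_one_pow]

theorem paritySign_emptyConfig : paritySign (emptyConfig L) = 1 := by
  simp [paritySign, emptyConfig]

theorem occ_nonneg (η : Config L) (k : ZMod L) : 0 ≤ occ η k := by
  unfold occ
  split_ifs <;> norm_num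

theorem occ_le_one (η : Config L) (k : ZMod L) : occ η k ≤ 1 := by
  unfold occ
  split_ifs <;> norm_num

theorem tiltedGen_eq_sum (μ w a : ℝ) (f : Config L → ℝ) (η : Config L) :
    tiltedGen μ w a f η = ∑ k : ZMod L, ((μ + a * (occ η k + occ η (k + 1))) * f (flip η k)
      - (μ + w * (occ η k + occ η (k + 1))) * f η) :=
  sum_range_natCast_zmod L fun k : ZMod L =>
    ((μ + a * (occ η k + occ η (k + 1))) * f (flip η k)
      - (μ + w * (occ η k + occ η (k + 1))) * f η)

theorem continuous_dominantVector {μ w : ℝ} (hμ : 0 < μ) (hw : 0 < w) (η : Config L) :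
    Continuous fun s : ℝ => dominantVector L μ w (w * Real.exp s) η := by
  let : NormedAlgebra ℚ ((Config L → ℝ) →L[ℝ] (Config L → ℝ)) :=
    NormedAlgebra.restrictScalars ℚ ℝ _
  have h1 : ∀ m : ZMod L, Continuous fun s : ℝ =>
      pairAmplitude μ w (w * Real.exp s) (momentum m) := by
    intro m
    unfold pairAmplitude
    refine Continuous.div (by fun_prop) ?_ fun s => ?_
    · unfold quasiEnergy kineticEnergy
      fun_prop
    · exact (sub_pos.2 (kineticEnergy_lt_quasiEnergy hμ hw (by positivity)
        (cos_momentum_lt_one m))).ne'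
  have h2 : Continuous fun s : ℝ => pairCreation (creator (L := L)) (covarianceMatrix
      fun m : ZMod L => pairAmplitude μ w (w * Real.exp s) (momentum m)) := by
    unfold pairCreation covarianceMatrix
    refine continuous_finsetSum _ fun i _ => continuous_finsetSum _ fun j _ => ?_
    refine Continuous.fun_smul ?_ continuous_const
    refine Continuous.div_const (continuous_finsetSum _ fun m _ => ?_) _
    exact (h1 m).mul continuous_const
  have h3 := (NormedSpace.exp_continuous
    (𝔸 := (Config L → ℝ) →L[ℝ] (Config L → ℝ))).comp h2
  exact (continuous_apply η).comp (h3.clm_apply continuous_const)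

/-- Without tilting the radicand is a perfect square; this makes the eigenvalue vanish at s = 0, as
it must for a Markov generator. -/
theorem quasiEnergy_untilted {μ w : ℝ} (hμ : 0 < μ) (hw : 0 < w) (θ : ℝ) :
    quasiEnergy μ w w θ = μ + w - w * Real.cos θ := by
  have h : kineticEnergy μ w w θ ^ 2 + μ * (μ + 2 * w) * Real.sin θ ^ 2
      = (μ + w - w * Real.cos θ) ^ 2 := by
    rw [kineticEnergy, Real.sin_sq]
    ring
  rw [quasiEnergy, h, Real.sqrt_sq]
  nlinarith [Real.cos_le_one θ]

variable [Fact (1 < L)]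

theorem dominantEigenvalue_untilted {μ w : ℝ} (hμ : 0 < μ) (hw : 0 < w) :
    dominantEigenvalue L μ w w = 0 := by
  rw [dominantEigenvalue]
  simp only [quasiEnergy_untilted hμ hw]
  rw [Finset.sum_sub_distrib, ← Finset.mul_sum, sum_cos_momentum Fact.out]
  simp
  ring

theorem paritySign_flip (η : Config L) (k : ZMod L) :
    paritySign (flip η k) = paritySign η := by
  rw [flip_eq_update, paritySign, prod_siteSign_update _ _ _ _ (Finset.mem_univ _),
    prod_siteSign_update _ _ _ _ (Finset.mem_univ _), Function.update_of_ne (succ_ne k),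
    paritySign]
  cases η k <;> cases η (k + 1) <;> simp

/-- Every even configuration is connected to the empty one by pair flips. -/
theorem emptyConfig_of_flip_closed (Z : Config L → Prop) (hZ : ∀ η k, Z η → Z (flip η k))
    {η : Config L} (hη : paritySign η = 1) (h : Z η) : Z (emptyConfig L) := by
  -- Sweep from left to right: a particle at site n is removed by flipping the bond (n, n + 1). At
  -- the end only the last site could be occupied, which even parity forbids.
  have key : ∀ n < L, ∃ ζ : Config L, Z ζ ∧ paritySign ζ = 1 ∧
      ∀ j : ZMod L, j.val < n → ζ j = false := by
    intro n
    induction n with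
    | zero => exact fun _ => ⟨η, h, hη, by simp⟩
    | succ n ih =>
      intro hn
      obtain ⟨ζ, h1, h2, h3⟩ := ih (by omega)
      have hval : (n : ZMod L).val = n := ZMod.val_cast_of_lt (by omega)
      have hsucc : ((n : ZMod L) + 1).val = n + 1 := by
        rw [val_succ_of_ne (by omega), hval]
      by_cases hz : ζ (n : ZMod L) = true
      · refine ⟨flip ζ n, hZ _ _ h1, by rw [paritySign_flip, h2], fun j hj => ?_⟩
        unfold flip
        by_cases hjn : j = (n : ZMod L)
        · simp [hjn, hz]
        · have h4 : j.val ≠ n := fun h => hjn (ZMod.val_injective L (h.trans hval.symm))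
          have h5 : j ≠ (n : ZMod L) + 1 := by
            rintro rfl
            omega
          rw [if_neg (by tauto), h3 j (by omega)]
      · refine ⟨ζ, h1, h2, fun j hj => ?_⟩
        by_cases hjn : j = (n : ZMod L)
        · simpa [hjn] using hz
        · have h4 : j.val ≠ n := fun h => hjn (ZMod.val_injective L (h.trans hval.symm))
          exact h3 j (by omega)
  have hL : 1 < L := Fact.out
  obtain ⟨ζ, h1, h2, h3⟩ := key (L - 1) (by omega)
  have hval : ((L - 1 : ℕ) : ZMod L).val = L - 1 := ZMod.val_cast_of_lt (by omega)
  have hlast := paritySign_eq_last (k := ((L - 1 : ℕ) : ZMod L)) (by omega) ζ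
  have hjw : jwSign ((L - 1 : ℕ) : ZMod L) ζ = 1 := by
    refine Finset.prod_eq_one fun j hj => ?_
    rw [h3 j (by simpa [hval] using hj), siteSign_false]
  have hz : ζ = emptyConfig L := by
    funext j
    by_cases hj : j.val < L - 1
    · exact h3 j hj
    · have hj' : j = ((L - 1 : ℕ) : ZMod L) := by
        apply ZMod.val_injective L
        have := ZMod.val_lt j
        omega
      rw [hj']
      rw [h2, hjw, mul_one] at hlast
      by_contra hne
      have : ζ ((L - 1 : ℕ) : ZMod L) = true := by simpa [emptyConfig] using hne
      rw [this] at hlast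
      norm_num at hlast
  exact hz ▸ h1

/-- A nonnegative eigenvector of the tilted generator on even configurations which does not vanish
on the empty configuration is positive. -/
theorem pos_of_nonneg_eigenvector {μ w a ρ : ℝ} (hμ : 0 < μ) (ha : 0 < a) {v : Config L → ℝ}
    (hv : ∀ η, paritySign η = 1 → 0 ≤ v η) (hv0 : v (emptyConfig L) ≠ 0)
    (heig : ∀ η, paritySign η = 1 → tiltedGen μ w a v η = ρ * v η)
    {η : Config L} (hη : paritySign η = 1) : 0 < v η := by
  refine lt_of_le_of_ne (hv η hη) fun h0 => hv0 ?_
  refine (emptyConfig_of_flip_closed (fun ζ => paritySign ζ = 1 ∧ v ζ = 0) ?_ hη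
    ⟨hη, h0.symm⟩).2
  rintro ζ k ⟨h1, h2⟩
  refine ⟨by rw [paritySign_flip, h1], ?_⟩
  -- At a zero of v the diagonal terms drop out, and a sum of nonnegative terms with positive rates
  -- vanishes; so v is zero at every neighbour.
  have h3 := heig ζ h1
  rw [tiltedGen_eq_sum, h2] at h3
  simp only [mul_zero, sub_zero] at h3
  have hrate : ∀ k, 0 < μ + a * (occ ζ k + occ ζ (k + 1)) := fun k => by
    have := occ_nonneg ζ k
    have := occ_nonneg ζ (k + 1)
    positivity
  have h4 := (Finset.sum_eq_zero_iff_of_nonneg fun k _ =>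
    mul_nonneg (hrate k).le (hv (flip ζ k) (by rw [paritySign_flip, h1]))).1 h3 k
      (Finset.mem_univ k)
  exact (mul_eq_zero.1 h4).resolve_left (hrate k).ne'

/-- A harmonic function of the untilted generator on even configurations is bounded below by its
value on the empty configuration. -/
theorem le_of_harmonic {μ w : ℝ} (hμ : 0 < μ) (hw : 0 < w) {v : Config L → ℝ}
    (heig : ∀ η, paritySign η = 1 → tiltedGen μ w w v η = 0)
    {η : Config L} (hη : paritySign η = 1) : v (emptyConfig L) ≤ v η := by
  -- Minimum principle: harmonicity spreads the minimal value to all neighbours, and so to the empty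
  -- configuration.
  obtain ⟨ζ₀, hζ₀, hmin⟩ := Finset.exists_min_image
    (Finset.univ.filter fun ζ : Config L => paritySign ζ = 1) v ⟨η, by simp [hη]⟩
  have hζ₀' : paritySign ζ₀ = 1 := by simpa using hζ₀
  have hmin' : ∀ ζ, paritySign ζ = 1 → v ζ₀ ≤ v ζ := fun ζ hζ => hmin ζ (by simp [hζ])
  refine le_trans (le_of_eq ?_) (hmin' η hη)
  refine (emptyConfig_of_flip_closed (fun ζ => paritySign ζ = 1 ∧ v ζ = v ζ₀) ?_ hζ₀'
    ⟨hζ₀', rfl⟩).2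
  rintro ζ k ⟨h1, h2⟩
  refine ⟨by rw [paritySign_flip, h1], ?_⟩
  have h3 := heig ζ h1
  rw [tiltedGen_eq_sum, h2] at h3
  simp only [← mul_sub] at h3
  have hrate : ∀ k, 0 < μ + w * (occ ζ k + occ ζ (k + 1)) := fun k => by
    have := occ_nonneg ζ k
    have := occ_nonneg ζ (k + 1)
    positivity
  have h4 := (Finset.sum_eq_zero_iff_of_nonneg fun k _ =>
    mul_nonneg (hrate k).le (sub_nonneg.2 (hmin' (flip ζ k) (by rw [paritySign_flip, h1])))).1 h3 k
      (Finset.mem_univ k)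
  exact sub_eq_zero.1 ((mul_eq_zero.1 h4).resolve_left (hrate k).ne')

/-- Continuity method in s. The set of s for which v is positive on even configurations is open; it
is closed because a nonnegative eigenvector with value 1 on the empty configuration is positive; and
it contains 0, where v is harmonic and therefore at least 1. -/
theorem dominantVector_pos {μ w : ℝ} (hμ : 0 < μ) (hw : 0 < w) (s : ℝ) {η : Config L}
    (hη : paritySign η = 1) : 0 < dominantVector L μ w (w * Real.exp s) η := by
  set v : ℝ → Config L → ℝ := fun s => dominantVector L μ w (w * Real.exp s) with hv
  have hcont : ∀ η, Continuous fun s => v s η := continuous_dominantVector hμ hw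
  have hempty : ∀ s, v s (emptyConfig L) = 1 := fun s => gaussianVector_emptyConfig _
  have heig : ∀ s η, paritySign η = 1 → tiltedGen μ w (w * Real.exp s) (v s) η
      = dominantEigenvalue L μ w (w * Real.exp s) * v s η := fun s η hη =>
    tiltedGen_dominantVector hμ hw (by positivity) η hη
  set P : Set ℝ := {s | ∀ η, paritySign η = 1 → 0 < v s η} with hP
  have hPeq : P = ⋂ η : Config L, ⋂ _ : paritySign η = 1, {s | 0 < v s η} := by
    ext s
    simp [hP]
  have hclopen : IsClopen P := by
    constructor
    · have h1 : P = ⋂ η : Config L, ⋂ _ : paritySign η = 1, {s | 0 ≤ v s η} := by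
        ext s
        simp only [hP, Set.mem_ofPred_eq, Set.mem_iInter]
        refine ⟨fun h η hη => (h η hη).le, fun h η hη => ?_⟩
        exact pos_of_nonneg_eigenvector hμ (by positivity) h (by rw [hempty]; exact one_ne_zero)
          (heig s) hη
      rw [h1]
      exact isClosed_iInter fun η => isClosed_iInter fun _ =>
        isClosed_le continuous_const (hcont η)
    · rw [hPeq]
      exact isOpen_iInter_of_finite fun η => isOpen_iInter_of_finite fun _ =>
        isOpen_lt continuous_const (hcont η)
  have h0 : (0 : ℝ) ∈ P := by
    intro η hη
    have h1 := le_of_harmonic hμ hw (v := v 0) (fun ζ hζ => by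
      have := heig 0 ζ hζ
      rwa [Real.exp_zero, mul_one, dominantEigenvalue_untilted hμ hw, zero_mul] at this) hη
    rw [hempty] at h1
    linarith
  have huniv : P = Set.univ :=
    (isClopen_iff.1 hclopen).resolve_left (Set.nonempty_of_mem h0).ne_empty
  have : s ∈ P := huniv ▸ Set.mem_univ s
  exact this η hη

end Positivity

/-! ### The moment generating function of the activity -/

section Semigroup

/-- A bound for the total rate of leaving a configuration. -/
def rateBound (μ w : ℝ) (L : ℕ) : ℝ := L * (μ + 2 * w)

/-- The generator of the joint process, shifted to have nonnegative matrix elements. -/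
def shiftedGenerator (μ w : ℝ) (L : ℕ) : BoundedFun L →L[ℝ] BoundedFun L :=
  jointGenerator μ w L + rateBound μ w L • 1

open Classical in
/-- The indicator function of a state. -/
def pointFun {L : ℕ} (y : JointState L) : BoundedFun L := lp.single ∞ y (1 : ℝ)

theorem pointFun_self {L : ℕ} (y : JointState L) : pointFun y y = 1 := by
  classical
  rw [pointFun, lp.coeFn_single]
  exact Pi.single_eq_same _ _

theorem pointFun_of_ne {L : ℕ} {x y : JointState L} (h : x ≠ y) : pointFun y x = 0 := by
  classical
  rw [pointFun, lp.coeFn_single]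
  exact Pi.single_eq_of_ne h _

/-- The matrix elements of the powers of the shifted generator. -/
def powerKernel (μ w : ℝ) (L n : ℕ) (x y : JointState L) : ℝ :=
  (shiftedGenerator μ w L ^ n) (pointFun y) x

/-- The tilted generator, shifted to have nonnegative matrix elements. -/
def shiftedTilted (μ w a : ℝ) (L : ℕ) (f : Config L → ℝ) (η : Config L) : ℝ :=
  tiltedGen μ w a f η + rateBound μ w L * f η

/-- The powers of the shifted tilted generator, applied to the constant function `1`. -/
def tiltedPower (μ w a : ℝ) (L n : ℕ) : Config L → ℝ :=
  (shiftedTilted μ w a L)^[n] fun _ => 1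

set_option linter.unusedSectionVars false

variable {μ w : ℝ} {L : ℕ} [NeZero L]

theorem hasSum_of_eq {ι : Type*} {f g : ι → ℝ} {x y : ℝ} (h : HasSum f x) (hfg : ∀ i, g i = f i)
    (hxy : y = x) : HasSum g y := by
  rw [funext hfg, hxy]
  exact h

/-- The bound allots to each bond its largest flip rate μ + 2w, so the diagonal coefficients become
nonnegative. -/
theorem jointGenFun_add_eq (f : JointState L → ℝ) (x : JointState L) :
    jointGenFun μ w L f x + rateBound μ w L * f x
      = ∑ k ∈ Finset.range L,
        (μ * f (flip x.1 k, x.2)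
          + w * (occ x.1 k + occ x.1 ((k : ZMod L) + 1)) * f (flip x.1 k, x.2 + 1)
          + w * (2 - occ x.1 k - occ x.1 ((k : ZMod L) + 1)) * f x) := by
  have h : rateBound μ w L * f x = ∑ _k ∈ Finset.range L, (μ + 2 * w) * f x := by
    rw [Finset.sum_const, Finset.card_range, rateBound]
    simp
    ring
  rw [jointGenFun, h, ← Finset.sum_add_distrib]
  refine Finset.sum_congr rfl fun k _ => ?_
  ring

theorem shiftedTilted_eq (a : ℝ) (f : Config L → ℝ) (η : Config L) :
    shiftedTilted μ w a L f η
      = ∑ k ∈ Finset.range L,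
        ((μ + a * (occ η k + occ η ((k : ZMod L) + 1))) * f (flip η k)
          + w * (2 - occ η k - occ η ((k : ZMod L) + 1)) * f η) := by
  have h : rateBound μ w L * f η = ∑ _k ∈ Finset.range L, (μ + 2 * w) * f η := by
    rw [Finset.sum_const, Finset.card_range, rateBound]
    simp
    ring
  rw [shiftedTilted, tiltedGen, h, ← Finset.sum_add_distrib]
  refine Finset.sum_congr rfl fun k _ => ?_
  ring

theorem powerKernel_succ (n : ℕ) (x y : JointState L) :
    powerKernel μ w L (n + 1) x y
      = jointGenFun μ w L (fun z => powerKernel μ w L n z y) x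
        + rateBound μ w L * powerKernel μ w L n x y := by
  unfold powerKernel
  rw [pow_succ', mul_apply_eq_comp]
  generalize (shiftedGenerator μ w L ^ n) (pointFun y) = g
  rw [shiftedGenerator, add_apply, lp.coeFn_add, Pi.add_apply, smul_apply, one_apply_eq_self,
    lp.coeFn_smul]
  rfl

theorem powerKernel_nonneg (hμ : 0 < μ) (hw : 0 < w) (n : ℕ) (x y : JointState L) :
    0 ≤ powerKernel μ w L n x y := by
  induction n generalizing x with
  | zero =>
    rw [powerKernel, pow_zero, one_apply_eq_self]
    by_cases h : x = y
    · rw [h, pointFun_self]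
      exact zero_le_one
    · rw [pointFun_of_ne h]
  | succ n ih =>
    rw [powerKernel_succ, jointGenFun_add_eq]
    refine Finset.sum_nonneg fun k _ => ?_
    have h1 := occ_nonneg x.1 k
    have h2 := occ_nonneg x.1 ((k : ZMod L) + 1)
    have h3 : 0 ≤ 2 - occ x.1 k - occ x.1 ((k : ZMod L) + 1) := by
      linarith [occ_le_one x.1 k, occ_le_one x.1 ((k : ZMod L) + 1)]
    have := ih x
    have := ih (flip x.1 k, x.2)
    have := ih (flip x.1 k, x.2 + 1)
    positivity

/-- A jump multiplies e^{sA} by e^s; this is where the tilting a = w e^s comes from. -/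
theorem jointGenFun_exp_mul (s : ℝ) (g : Config L → ℝ) (x : JointState L) :
    jointGenFun μ w L (fun z => Real.exp (s * z.2) * g z.1) x
      = Real.exp (s * x.2) * tiltedGen μ w (w * Real.exp s) g x.1 := by
  rw [jointGenFun, tiltedGen, Finset.mul_sum]
  refine Finset.sum_congr rfl fun k _ => ?_
  push_cast
  rw [mul_add s, mul_one, Real.exp_add]
  ring

theorem hasSum_jointGenFun {ι : Type*} {F : JointState L → ι → ℝ} {G : JointState L → ℝ}
    (h : ∀ z, HasSum (F z) (G z)) (x : JointState L) :
    HasSum (fun y => jointGenFun μ w L (fun z => F z y) x) (jointGenFun μ w L G x) :=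
  hasSum_sum fun _ _ => (((h _).mul_left _).add ((h _).mul_left _)).sub ((h _).mul_left _)

/-- For s > 0 the function e^{sA} is unbounded, and the semigroup on bounded functions cannot be
applied to it. Its expectation is therefore assembled from the point kernels of each power, where an
induction step involves finitely many terms. -/
theorem hasSum_powerKernel (s : ℝ) (n : ℕ) (x : JointState L) :
    HasSum (fun y : JointState L => Real.exp (s * y.2) * powerKernel μ w L n x y)
      (Real.exp (s * x.2) * tiltedPower μ w (w * Real.exp s) L n x.1) := by
  induction n generalizing x with
  | zero =>
    have h : ∀ y : JointState L, y ≠ x → Real.exp (s * y.2) * powerKernel μ w L 0 x y = 0 := by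
      intro y hy
      rw [powerKernel, pow_zero, one_apply_eq_self, pointFun_of_ne (Ne.symm hy), mul_zero]
    refine hasSum_of_eq (hasSum_single x h) (fun _ => rfl) ?_
    rw [powerKernel, pow_zero, one_apply_eq_self, pointFun_self]
    rfl
  | succ n ih =>
    have h1 := (hasSum_jointGenFun (μ := μ) (w := w) ih x).add
      ((ih x).mul_left (rateBound μ w L))
    rw [jointGenFun_exp_mul] at h1
    refine hasSum_of_eq h1 (fun y => ?_) ?_
    · rw [powerKernel_succ, mul_add]
      congr 1
      · rw [jointGenFun, jointGenFun, Finset.mul_sum]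
        refine Finset.sum_congr rfl fun k _ => ?_
        ring
      · ring
    · rw [tiltedPower, Function.iterate_succ', Function.comp_apply, shiftedTilted]
      unfold tiltedPower
      ring

/-- Uniformisation: a scalar is split off the exponent, so that for suitable c and t ≥ 0 the series
has nonnegative matrix elements. -/
theorem hasSum_exp_smul {A : Type*} [NormedRing A] [NormedAlgebra ℝ A] [CompleteSpace A]
    (J : A) (t c : ℝ) :
    HasSum (fun n : ℕ => (Real.exp (-(t * c)) * (t ^ n / n.factorial)) • (J + c • 1) ^ n)
      (NormedSpace.exp (t • J)) := by
  let : NormedAlgebra ℚ A := NormedAlgebra.restrictScalars ℚ ℝ A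
  have h1 : t • J = algebraMap ℝ A (-(t * c)) + t • (J + c • 1) := by
    rw [Algebra.algebraMap_eq_smul_one]
    module
  have h2 : NormedSpace.exp (t • J)
      = Real.exp (-(t * c)) • NormedSpace.exp (t • (J + c • 1)) := by
    rw [h1, NormedSpace.exp_add_of_commute (Algebra.commutes _ _),
      ← NormedSpace.algebraMap_exp_comm, ← Real.exp_eq_exp_ℝ, Algebra.algebraMap_eq_smul_one,
      smul_one_mul]
  rw [h2]
  have h3 := (NormedSpace.exp_series_hasSum_exp' (𝕂 := ℝ) (t • (J + c • 1))).const_smul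
    (Real.exp (-(t * c)))
  refine h3.congr_fun fun n => ?_
  rw [smul_pow, smul_smul, smul_smul]
  congr 1
  ring

theorem hasSum_transitionProb (t : ℝ) (x y : JointState L) :
    HasSum (fun n : ℕ => Real.exp (-(t * rateBound μ w L)) * (t ^ n / n.factorial)
      * powerKernel μ w L n x y) (transitionProb μ w L t x y) :=
  (hasSum_exp_smul (jointGenerator μ w L) t (rateBound μ w L)).mapL
    ((lp.evalCLM ℝ (fun _ : JointState L => ℝ) ∞ x).comp
      (ContinuousLinearMap.apply ℝ (BoundedFun L) (pointFun y)))

end Semigroup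

/-! ### Growth rate of the tilted semigroup and existence of the limit K -/

section Growth

set_option linter.unusedSectionVars false

variable {μ w : ℝ} {L : ℕ} [NeZero L] [Fact (1 < L)]

theorem shiftedTilted_mono (hμ : 0 < μ) (hw : 0 < w) {a : ℝ} (ha : 0 < a) {f g : Config L → ℝ}
    (h : ∀ η, paritySign η = 1 → f η ≤ g η) {η : Config L} (hη : paritySign η = 1) :
    shiftedTilted μ w a L f η ≤ shiftedTilted μ w a L g η := by
  rw [shiftedTilted_eq, shiftedTilted_eq]
  refine Finset.sum_le_sum fun k _ => ?_
  have h1 := occ_nonneg η k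
  have h2 := occ_nonneg η ((k : ZMod L) + 1)
  have h3 : 0 ≤ 2 - occ η k - occ η ((k : ZMod L) + 1) := by
    linarith [occ_le_one η k, occ_le_one η ((k : ZMod L) + 1)]
  exact add_le_add
    (mul_le_mul_of_nonneg_left (h _ (by rw [paritySign_flip, hη])) (by positivity))
    (mul_le_mul_of_nonneg_left (h η hη) (by positivity))

theorem shiftedTilted_smul (a c : ℝ) (f : Config L → ℝ) (η : Config L) :
    shiftedTilted μ w a L (fun ζ => c * f ζ) η = c * shiftedTilted μ w a L f η := by
  rw [shiftedTilted_eq, shiftedTilted_eq, Finset.mul_sum]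
  refine Finset.sum_congr rfl fun k _ => ?_
  ring

/-- The powers of the shifted tilted generator grow at the rate of the dominant eigenvalue. -/
theorem exists_tiltedPower_bounds (hμ : 0 < μ) (hw : 0 < w) (s : ℝ) {η : Config L}
    (hη : paritySign η = 1) :
    ∃ c C : ℝ, 0 < c ∧ 0 < C ∧ ∀ n : ℕ,
      c * (dominantEigenvalue L μ w (w * Real.exp s) + rateBound μ w L) ^ n
        ≤ tiltedPower μ w (w * Real.exp s) L n η ∧
      tiltedPower μ w (w * Real.exp s) L n η
        ≤ C * (dominantEigenvalue L μ w (w * Real.exp s) + rateBound μ w L) ^ n := by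
  set a := w * Real.exp s with ha
  have ha0 : 0 < a := by positivity
  set v := dominantVector L μ w a with hv
  have hvpos : ∀ ζ, paritySign ζ = 1 → 0 < v ζ := fun ζ hζ => dominantVector_pos hμ hw s hζ
  set ρ := dominantEigenvalue L μ w a + rateBound μ w L with hρ
  have heig : ∀ ζ, paritySign ζ = 1 → shiftedTilted μ w a L v ζ = ρ * v ζ := by
    intro ζ hζ
    rw [shiftedTilted, tiltedGen_dominantVector hμ hw ha0 ζ hζ]
    ring
  have hne : (Finset.univ.filter fun ζ : Config L => paritySign ζ = 1).Nonempty :=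
    ⟨emptyConfig L, by simp [paritySign_emptyConfig]⟩
  -- On even configurations 1 lies between v / max v and v / min v. The shifted tilted generator is
  -- monotone there, so its powers applied to 1 stay between multiples of ρⁿ v.
  obtain ⟨ζ₁, hζ₁, hmax⟩ := Finset.exists_max_image _ v hne
  obtain ⟨ζ₂, hζ₂, hmin⟩ := Finset.exists_min_image _ v hne
  have h1 := hvpos ζ₁ (by simpa using hζ₁)
  have h2 := hvpos ζ₂ (by simpa using hζ₂)
  have hlow : ∀ n ζ, paritySign ζ = 1 → (v ζ₁)⁻¹ * ρ ^ n * v ζ ≤ tiltedPower μ w a L n ζ := by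
    intro n
    induction n with
    | zero =>
      intro ζ hζ
      change _ ≤ (1 : ℝ)
      rw [pow_zero, mul_one, inv_mul_le_iff₀ h1, mul_one]
      exact hmax ζ (by simp [hζ])
    | succ n ih =>
      intro ζ hζ
      have h3 := shiftedTilted_mono hμ hw ha0 ih hζ
      rw [shiftedTilted_smul, heig ζ hζ] at h3
      rw [tiltedPower, Function.iterate_succ', Function.comp_apply]
      refine le_trans (le_of_eq ?_) h3
      ring
  have hhigh : ∀ n ζ, paritySign ζ = 1 → tiltedPower μ w a L n ζ ≤ (v ζ₂)⁻¹ * ρ ^ n * v ζ := by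
    intro n
    induction n with
    | zero =>
      intro ζ hζ
      change (1 : ℝ) ≤ _
      rw [pow_zero, mul_one, inv_mul_eq_div, one_le_div h2]
      exact hmin ζ (by simp [hζ])
    | succ n ih =>
      intro ζ hζ
      have h3 := shiftedTilted_mono hμ hw ha0 ih hζ
      rw [shiftedTilted_smul, heig ζ hζ] at h3
      rw [tiltedPower, Function.iterate_succ', Function.comp_apply]
      refine le_trans h3 (le_of_eq ?_)
      ring
  have h3 := hvpos η hη
  refine ⟨(v ζ₁)⁻¹ * v η, (v ζ₂)⁻¹ * v η, by positivity, by positivity, fun n => ⟨?_, ?_⟩⟩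
  · exact le_trans (le_of_eq (by ring)) (hlow n η hη)
  · exact le_trans (hhigh n η hη) (le_of_eq (by ring))

theorem tiltedPower_nonneg (hμ : 0 < μ) (hw : 0 < w) {a : ℝ} (ha : 0 < a) (n : ℕ)
    (η : Config L) : 0 ≤ tiltedPower μ w a L n η := by
  induction n generalizing η with
  | zero => exact zero_le_one
  | succ n ih =>
    rw [tiltedPower, Function.iterate_succ', Function.comp_apply, shiftedTilted_eq]
    refine Finset.sum_nonneg fun k _ => ?_
    have h1 := occ_nonneg η k
    have h2 := occ_nonneg η ((k : ZMod L) + 1)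
    have h3 : 0 ≤ 2 - occ η k - occ η ((k : ZMod L) + 1) := by
      linarith [occ_le_one η k, occ_le_one η ((k : ZMod L) + 1)]
    exact add_nonneg (mul_nonneg (by positivity) (ih _)) (mul_nonneg (by positivity) (ih _))

theorem hasSum_pow_mul (t ρ : ℝ) :
    HasSum (fun n : ℕ => t ^ n / n.factorial * ρ ^ n) (Real.exp (t * ρ)) := by
  have h := NormedSpace.expSeries_div_hasSum_exp (t * ρ)
  rw [← Real.exp_eq_exp_ℝ] at h
  refine hasSum_of_eq h (fun n => ?_) rfl
  rw [mul_pow]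
  ring

/-- The moment generating function of the activity converges and is given by the semigroup of the
tilted generator. -/
theorem hasSum_activityMGF (hμ : 0 < μ) (hw : 0 < w) (s : ℝ) {η : Config L}
    (hη : paritySign η = 1) {t : ℝ} (ht : 0 ≤ t) :
    (Summable fun y : JointState L => Real.exp (s * y.2) * transitionProb μ w L t (η, 0) y) ∧
    HasSum (fun n : ℕ => Real.exp (-(t * rateBound μ w L)) * (t ^ n / n.factorial)
      * tiltedPower μ w (w * Real.exp s) L n η) (activityMGF μ w L η s t) := by
  obtain ⟨c, C, hc, hC, hbound⟩ := exists_tiltedPower_bounds (L := L) hμ hw s hη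
  set a := w * Real.exp s with ha
  have ha0 : 0 < a := by positivity
  set ρ := dominantEigenvalue L μ w a + rateBound μ w L with hρ
  set r := Real.exp (-(t * rateBound μ w L)) with hr
  have hr0 : 0 < r := Real.exp_pos _
  -- A nonnegative double series: for fixed n it sums to a tilted power, for fixed state to a
  -- weighted transition probability, and Tonelli exchanges the two orders.
  set F : ℕ × JointState L → ℝ := fun p =>
    r * (t ^ p.1 / p.1.factorial) * (Real.exp (s * p.2.2) * powerKernel μ w L p.1 (η, 0) p.2)
    with hF
  have hF0 : 0 ≤ F := fun p =>
    mul_nonneg (by positivity) (mul_nonneg (by positivity) (powerKernel_nonneg hμ hw _ _ _))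
  have hrow : ∀ n, HasSum (fun y => F (n, y))
      (r * (t ^ n / n.factorial) * tiltedPower μ w a L n η) := by
    intro n
    have h1 := (hasSum_powerKernel (μ := μ) (w := w) s n ((η, 0) : JointState L)).mul_left
      (r * (t ^ n / n.factorial))
    simpa using h1
  have hsum : Summable fun n : ℕ => r * (t ^ n / n.factorial) * tiltedPower μ w a L n η := by
    refine Summable.of_nonneg_of_le (fun n => mul_nonneg (by positivity)
      (tiltedPower_nonneg hμ hw ha0 n η))
      (fun n => mul_le_mul_of_nonneg_left (hbound n).2 (by positivity))
      (((hasSum_pow_mul t ρ).summable.mul_left (r * C)).congr fun n => ?_)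
    ring
  have hFsum : Summable F := by
    refine (summable_prod_of_nonneg hF0).2 ⟨fun n => (hrow n).summable, ?_⟩
    simpa only [(hrow _).tsum_eq] using hsum
  have hcol : ∀ y, HasSum (fun n => F (n, y))
      (Real.exp (s * y.2) * transitionProb μ w L t (η, 0) y) := by
    intro y
    refine hasSum_of_eq ((hasSum_transitionProb (μ := μ) (w := w) t
      ((η, 0) : JointState L) y).mul_left (Real.exp (s * y.2))) (fun n => ?_) rfl
    simp only [hF]
    ring
  have hswap : HasSum (F ∘ Prod.swap) (∑' p, F p) :=
    (Equiv.prodComm (JointState L) ℕ).hasSum_iff.2 hFsum.hasSum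
  have h1 : HasSum (fun y : JointState L => Real.exp (s * y.2) * transitionProb μ w L t (η, 0) y)
      (∑' p, F p) := hswap.prod_fiberwise hcol
  refine ⟨h1.summable, ?_⟩
  rw [activityMGF, h1.tsum_eq]
  exact hFsum.hasSum.prod_fiberwise hrow

theorem exists_activityMGF_bounds (hμ : 0 < μ) (hw : 0 < w) (s : ℝ) {η : Config L}
    (hη : paritySign η = 1) :
    ∃ c C : ℝ, 0 < c ∧ 0 < C ∧ ∀ t : ℝ, 0 ≤ t →
      c * Real.exp (t * dominantEigenvalue L μ w (w * Real.exp s)) ≤ activityMGF μ w L η s t ∧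
      activityMGF μ w L η s t ≤ C * Real.exp (t * dominantEigenvalue L μ w (w * Real.exp s)) := by
  obtain ⟨c, C, hc, hC, hbound⟩ := exists_tiltedPower_bounds (L := L) hμ hw s hη
  refine ⟨c, C, hc, hC, fun t ht => ?_⟩
  have h := (hasSum_activityMGF hμ hw s hη ht).2
  set Λ := dominantEigenvalue L μ w (w * Real.exp s) with hΛ
  set r := Real.exp (-(t * rateBound μ w L)) with hr
  have hr0 : 0 < r := Real.exp_pos _
  have hexp : ∀ b : ℝ, HasSum (fun n : ℕ => r * (t ^ n / n.factorial)
      * (b * (Λ + rateBound μ w L) ^ n)) (b * Real.exp (t * Λ)) := by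
    intro b
    have h1 := (hasSum_pow_mul t (Λ + rateBound μ w L)).mul_left (r * b)
    have h2 : r * b * Real.exp (t * (Λ + rateBound μ w L)) = b * Real.exp (t * Λ) := by
      rw [mul_comm r b, mul_assoc, hr, ← Real.exp_add]
      congr 2
      ring
    rw [h2] at h1
    refine hasSum_of_eq h1 (fun n => ?_) rfl
    ring
  exact ⟨hasSum_le (fun n => mul_le_mul_of_nonneg_left (hbound n).1 (by positivity)) (hexp c) h,
    hasSum_le (fun n => mul_le_mul_of_nonneg_left (hbound n).2 (by positivity)) h (hexp C)⟩

/-- Both bounds are a constant times e^{tΛ}. Only the constants depend on the initial configuration,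
and division by Lt removes them in the limit. -/
theorem tendsto_scaledLogMGF (hμ : 0 < μ) (hw : 0 < w) (s : ℝ) {η : Config L}
    (hη : paritySign η = 1) :
    Tendsto (fun t : ℝ => scaledLogMGF μ w L η s t) atTop
      (𝓝 (dominantEigenvalue L μ w (w * Real.exp s) / L)) := by
  obtain ⟨c, C, hc, hC, hbound⟩ := exists_activityMGF_bounds (L := L) hμ hw s hη
  set Λ := dominantEigenvalue L μ w (w * Real.exp s) with hΛ
  have hL : (0 : ℝ) < L := Nat.cast_pos.2 (NeZero.pos L)
  have hlim : ∀ b : ℝ, Tendsto (fun t : ℝ => b / (L * t) + Λ / L) atTop (𝓝 (Λ / L)) := by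
    intro b
    have h1 : Tendsto (fun t : ℝ => b / (L * t)) atTop (𝓝 0) :=
      tendsto_const_nhds.div_atTop (tendsto_id.const_mul_atTop hL)
    simpa using h1.add_const (Λ / L)
  have hlog : ∀ b t : ℝ, 0 < b → 0 < t →
      Real.log (b * Real.exp (t * Λ)) / (L * t) = Real.log b / (L * t) + Λ / L := by
    intro b t hb ht
    rw [Real.log_mul hb.ne' (Real.exp_pos _).ne', Real.log_exp]
    field_simp
  refine tendsto_of_tendsto_of_tendsto_of_le_of_le' (hlim (Real.log c)) (hlim (Real.log C)) ?_ ?_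
  · filter_upwards [eventually_gt_atTop 0] with t ht
    rw [← hlog c t hc ht, scaledLogMGF]
    have := (hbound t ht.le).1
    gcongr
  · filter_upwards [eventually_gt_atTop 0] with t ht
    rw [← hlog C t hC ht, scaledLogMGF]
    have h1 := (hbound t ht.le).1
    have h2 := (hbound t ht.le).2
    have : 0 < activityMGF μ w L η s t := lt_of_lt_of_le (by positivity) h1
    gcongr

theorem cgf_eq (hμ : 0 < μ) (hw : 0 < w) (s : ℝ) :
    cgf μ w L s = dominantEigenvalue L μ w (w * Real.exp s) / L :=
  (tendsto_scaledLogMGF hμ hw s paritySign_emptyConfig).limUnder_eq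

theorem contDiff_cgf (hμ : 0 < μ) (hw : 0 < w) : ContDiff ℝ ∞ (cgf μ w L) := by
  rw [show cgf μ w L = fun s => dominantEigenvalue L μ w (w * Real.exp s) / L from
    funext fun s => cgf_eq hμ hw s]
  unfold dominantEigenvalue
  refine ContDiff.div_const (ContDiff.sub (ContDiff.sum fun m _ => ?_) contDiff_const) _
  unfold quasiEnergy
  refine ContDiff.sqrt ?_ fun s => (quasiEnergy_radicand_pos hμ hw (by positivity)
    (cos_momentum_lt_one m)).ne'
  unfold kineticEnergy
  fun_prop

end Growth

/-! ### The midpoint rule with its first correction -/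

/-- A Taylor estimate for a function whose successive derivatives are `f 1, …, f n`. -/
theorem abs_sub_taylor_le {B : ℝ} (n : ℕ) (f : ℕ → ℝ → ℝ) (x₀ x : ℝ)
    (hf : ∀ k < n, ∀ t, |t - x₀| ≤ |x - x₀| → HasDerivAt (f k) (f (k + 1) t) t)
    (hB : ∀ t, |t - x₀| ≤ |x - x₀| → |f n t| ≤ B) :
    |f 0 x - ∑ k ∈ Finset.range n, (x - x₀) ^ k / k.factorial * f k x₀| ≤ B * |x - x₀| ^ n := by
  induction n generalizing f x with
  | zero => simpa using hB x le_rfl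
  | succ n ih =>
    -- The remainder vanishes at x₀, and its derivative is the remainder of one order less for the
    -- shifted sequence; the mean value inequality closes the induction.
    set R : ℝ → ℝ := fun t =>
      f 0 t - ∑ k ∈ Finset.range (n + 1), (t - x₀) ^ k / k.factorial * f k x₀ with hR
    set R' : ℝ → ℝ := fun t =>
      f 1 t - ∑ k ∈ Finset.range n, (t - x₀) ^ k / k.factorial * f (k + 1) x₀ with hR'
    have hderiv : ∀ t, |t - x₀| ≤ |x - x₀| → HasDerivAt R (R' t) t := by
      intro t ht
      have h1 : HasDerivAt (fun t => ∑ k ∈ Finset.range n,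
          (t - x₀) ^ (k + 1) / (k + 1).factorial * f (k + 1) x₀)
          (∑ k ∈ Finset.range n, (t - x₀) ^ k / k.factorial * f (k + 1) x₀) t := by
        refine HasDerivAt.fun_sum fun k _ => ?_
        have h2 := ((((hasDerivAt_id t).sub_const x₀).pow (k + 1)).div_const
          ((k + 1).factorial : ℝ)).mul_const (f (k + 1) x₀)
        refine h2.congr_deriv ?_
        rw [Nat.factorial_succ]
        push_cast
        have : (k.factorial : ℝ) ≠ 0 := by positivity
        simp only [id, mul_one]
        field_simp
      have h3 := (hf 0 (by omega) t ht).sub (h1.add_const (f 0 x₀))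
      have h4 : R = (f 0) - fun t => (∑ k ∈ Finset.range n,
          (t - x₀) ^ (k + 1) / (k + 1).factorial * f (k + 1) x₀) + f 0 x₀ := by
        funext t
        simp only [hR, Pi.sub_apply]
        rw [Finset.sum_range_succ']
        simp
      rw [h4]
      exact h3
    have hbound : ∀ t, |t - x₀| ≤ |x - x₀| → |R' t| ≤ B * |x - x₀| ^ n := by
      intro t ht
      have h1 := ih (fun k => f (k + 1)) t
        (fun k hk s hs => hf (k + 1) (by omega) s (hs.trans ht)) (fun s hs => hB s (hs.trans ht))
      have hB0 : 0 ≤ B := (abs_nonneg _).trans (hB x le_rfl)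
      exact h1.trans (mul_le_mul_of_nonneg_left (pow_le_pow_left₀ (abs_nonneg _) ht n) hB0)
    have hconv : Convex ℝ (Metric.closedBall x₀ |x - x₀|) := convex_closedBall _ _
    have hmem : ∀ t, t ∈ Metric.closedBall x₀ |x - x₀| ↔ |t - x₀| ≤ |x - x₀| := fun t => by
      rw [Metric.mem_closedBall, Real.dist_eq]
    have h5 := hconv.norm_image_sub_le_of_norm_hasDerivWithin_le
      (fun t ht => (hderiv t ((hmem t).1 ht)).hasDerivWithinAt)
      (fun t ht => hbound t ((hmem t).1 ht)) ((hmem x₀).2 (by simp)) ((hmem x).2 le_rfl)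
    have h6 : R x₀ = 0 := by
      simp only [hR]
      rw [Finset.sum_range_succ']
      simp
    rw [h6, sub_zero, Real.norm_eq_abs, Real.norm_eq_abs] at h5
    rw [pow_succ, ← mul_assoc]
    exact h5

theorem hasDerivAt_iteratedDeriv {Φ : ℝ → ℝ} (hΦ : ContDiff ℝ ∞ Φ) (k : ℕ) (t : ℝ) :
    HasDerivAt (iteratedDeriv k Φ) (iteratedDeriv (k + 1) Φ t) t := by
  rw [iteratedDeriv_succ]
  exact ((hΦ.differentiable_iteratedDeriv k (by exact_mod_cast WithTop.coe_lt_top _)) t).hasDerivAt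

/-- The error of the midpoint rule on one cell. -/
theorem abs_midpoint_cell_le {Φ : ℝ → ℝ} (hΦ : ContDiff ℝ ∞ Φ) {B m h : ℝ} (hh : 0 ≤ h)
    (hB : ∀ t, |t - m| ≤ h → |iteratedDeriv 4 Φ t| ≤ B) :
    |2 * h * iteratedDeriv 1 Φ m - (Φ (m + h) - Φ (m - h))
      + h ^ 2 / 6 * (iteratedDeriv 2 Φ (m + h) - iteratedDeriv 2 Φ (m - h))| ≤ 3 * B * h ^ 4 := by
  have hp : |m + h - m| = h := by rw [add_sub_cancel_left, abs_of_nonneg hh]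
  have hm : |m - h - m| = h := by rw [sub_sub_cancel_left, abs_neg, abs_of_nonneg hh]
  have hB0 : 0 ≤ B := (abs_nonneg _).trans (hB m (by simpa using hh))
  -- Φ is expanded to third order and Φ″ to first order about m. The terms h³Φ‴/3 cancel, and the
  -- remainders add up to (2 + 1/3) B h⁴.
  have a1 := abs_sub_taylor_le (B := B) 4 (fun k => iteratedDeriv k Φ) m (m + h)
    (fun k _ t _ => hasDerivAt_iteratedDeriv hΦ k t) (fun t ht => hB t (hp ▸ ht))
  have a2 := abs_sub_taylor_le (B := B) 4 (fun k => iteratedDeriv k Φ) m (m - h)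
    (fun k _ t _ => hasDerivAt_iteratedDeriv hΦ k t) (fun t ht => hB t (hm ▸ ht))
  have a3 := abs_sub_taylor_le (B := B) 2 (fun k => iteratedDeriv (k + 2) Φ) m (m + h)
    (fun k _ t _ => hasDerivAt_iteratedDeriv hΦ (k + 2) t) (fun t ht => hB t (hp ▸ ht))
  have a4 := abs_sub_taylor_le (B := B) 2 (fun k => iteratedDeriv (k + 2) Φ) m (m - h)
    (fun k _ t _ => hasDerivAt_iteratedDeriv hΦ (k + 2) t) (fun t ht => hB t (hm ▸ ht))
  rw [hp] at a1 a3
  rw [hm] at a2 a4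
  simp only [Finset.sum_range_succ, Finset.sum_range_zero, Nat.factorial, add_sub_cancel_left,
    sub_sub_cancel_left, iteratedDeriv_zero] at a1 a2 a3 a4
  norm_num at a1 a2 a3 a4
  rw [iteratedDeriv_one]
  rw [abs_le] at a1 a2 a3 a4 ⊢
  have h2 : 0 ≤ h ^ 2 := by positivity
  have b3 := mul_le_mul_of_nonneg_left a3.1 h2
  have b3' := mul_le_mul_of_nonneg_left a3.2 h2
  have b4 := mul_le_mul_of_nonneg_left a4.1 h2
  have b4' := mul_le_mul_of_nonneg_left a4.2 h2
  have h4 : 0 ≤ B * h ^ 4 := by positivity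
  constructor <;> nlinarith

/-- The nodes of the midpoint rule on `[0, π]`. -/
def midpointNode (L j : ℕ) : ℝ := Real.pi * (2 * j + 1) / (2 * L)

/-- The Euler–Maclaurin correction of the midpoint rule on `[0, π]`. -/
theorem tendsto_midpoint {Φ : ℝ → ℝ} (hΦ : ContDiff ℝ ∞ Φ) :
    Tendsto (fun L : ℕ => (L : ℝ) ^ 2 * (Real.pi / L
        * ∑ j ∈ Finset.range L, iteratedDeriv 1 Φ (midpointNode L j) - (Φ Real.pi - Φ 0)))
      atTop (𝓝 (-(Real.pi ^ 2 / 24)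
        * (iteratedDeriv 2 Φ Real.pi - iteratedDeriv 2 Φ 0))) := by
  obtain ⟨B, hB⟩ := (isCompact_Icc (a := (0 : ℝ)) (b := Real.pi)).exists_bound_of_continuousOn
    (continuous_iff_continuousAt.2 fun t =>
      (hasDerivAt_iteratedDeriv hΦ 4 t).continuousAt).continuousOn
  have hB0 : 0 ≤ B := (norm_nonneg _).trans (hB 0 ⟨le_rfl, Real.pi_pos.le⟩)
  have key : ∀ L : ℕ, 0 < L →
      |(L : ℝ) ^ 2 * (Real.pi / L * ∑ j ∈ Finset.range L, iteratedDeriv 1 Φ (midpointNode L j)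
        - (Φ Real.pi - Φ 0)) - (-(Real.pi ^ 2 / 24)
        * (iteratedDeriv 2 Φ Real.pi - iteratedDeriv 2 Φ 0))| ≤ 3 * B * Real.pi ^ 4 / 16 / L := by
    intro L hL
    have hL' : (0 : ℝ) < L := Nat.cast_pos.2 hL
    set h : ℝ := Real.pi / (2 * L) with hh
    have hh0 : 0 ≤ h := by positivity
    have hplus : ∀ j : ℕ, midpointNode L j + h = Real.pi * (j + 1 : ℕ) / L := by
      intro j
      rw [midpointNode, hh]
      push_cast
      field_simp
      ring
    have hminus : ∀ j : ℕ, midpointNode L j - h = Real.pi * (j : ℕ) / L := by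
      intro j
      rw [midpointNode, hh]
      field_simp
      ring
    have hcell : ∀ j ∈ Finset.range L, |2 * h * iteratedDeriv 1 Φ (midpointNode L j)
        - (Φ (Real.pi * (j + 1 : ℕ) / L) - Φ (Real.pi * (j : ℕ) / L))
        + h ^ 2 / 6 * (iteratedDeriv 2 Φ (Real.pi * (j + 1 : ℕ) / L)
          - iteratedDeriv 2 Φ (Real.pi * (j : ℕ) / L))| ≤ 3 * B * h ^ 4 := by
      intro j hj
      rw [← hplus, ← hminus]
      refine abs_midpoint_cell_le hΦ hh0 fun t ht => hB t ?_
      rw [abs_le] at ht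
      have h1 : 0 ≤ midpointNode L j - h := by
        rw [hminus]
        positivity
      have h2 : midpointNode L j + h ≤ Real.pi := by
        rw [hplus, div_le_iff₀ hL']
        have : ((j + 1 : ℕ) : ℝ) ≤ L := by exact_mod_cast Finset.mem_range.1 hj
        exact mul_le_mul_of_nonneg_left this Real.pi_pos.le
      constructor <;> linarith
    -- The increments of Φ and Φ″ telescope; L cells with errors of order L⁻⁴ leave L⁻¹ after
    -- multiplication by L².
    have hsum := (Finset.abs_sum_le_sum_abs _ _).trans (Finset.sum_le_sum hcell)
    rw [Finset.sum_add_distrib, Finset.sum_sub_distrib, ← Finset.mul_sum, ← Finset.mul_sum,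
      Finset.sum_range_sub (fun j => Φ (Real.pi * (j : ℕ) / L)),
      Finset.sum_range_sub (fun j => iteratedDeriv 2 Φ (Real.pi * (j : ℕ) / L)), Finset.sum_const,
      Finset.card_range, nsmul_eq_mul] at hsum
    rw [mul_div_cancel_right₀ _ hL'.ne'] at hsum
    simp only [Nat.cast_zero, mul_zero, zero_div] at hsum
    have e1 : (L : ℝ) ^ 2 * (Real.pi / L * ∑ j ∈ Finset.range L,
          iteratedDeriv 1 Φ (midpointNode L j) - (Φ Real.pi - Φ 0)) - (-(Real.pi ^ 2 / 24)
        * (iteratedDeriv 2 Φ Real.pi - iteratedDeriv 2 Φ 0))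
        = (L : ℝ) ^ 2 * (2 * h * ∑ j ∈ Finset.range L, iteratedDeriv 1 Φ (midpointNode L j)
          - (Φ Real.pi - Φ 0) + h ^ 2 / 6 * (iteratedDeriv 2 Φ Real.pi - iteratedDeriv 2 Φ 0)) := by
      rw [hh]
      field_simp
      ring
    rw [e1, abs_mul, abs_of_nonneg (by positivity : (0 : ℝ) ≤ (L : ℝ) ^ 2)]
    refine (mul_le_mul_of_nonneg_left hsum (by positivity)).trans (le_of_eq ?_)
    rw [hh]
    field_simp
    ring
  rw [tendsto_iff_dist_tendsto_zero]
  refine squeeze_zero' (Eventually.of_forall fun _ => dist_nonneg) ?_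
    (tendsto_const_div_atTop_nhds_zero_nat (3 * B * Real.pi ^ 4 / 16))
  filter_upwards [eventually_gt_atTop 0] with L hL
  rw [Real.dist_eq]
  exact key L hL

/-! ### The free energy at the critical point -/

/-- An antiderivative of the critical dispersion relation. -/
def criticalPrimitive (ν q : ℝ) : ℝ :=
  -(Real.cos q * √(1 - ν ^ 2 * Real.cos q ^ 2) + Real.arcsin (ν * Real.cos q) / ν)

/-- The critical dispersion relation. -/
def criticalDispersion (ν q : ℝ) : ℝ := 2 * Real.sin q * √(1 - ν ^ 2 * Real.cos q ^ 2)

section Critical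

variable {ν : ℝ}

theorem critical_radicand_pos (hν0 : 0 < ν) (hν1 : ν < 1) (q : ℝ) :
    0 < 1 - ν ^ 2 * Real.cos q ^ 2 := by
  have h1 := Real.cos_sq_le_one q
  have h2 : ν ^ 2 < 1 := by nlinarith
  nlinarith [sq_nonneg (Real.cos q), sq_nonneg ν]

theorem abs_mul_cos_lt_one (hν0 : 0 < ν) (hν1 : ν < 1) (q : ℝ) : |ν * Real.cos q| < 1 := by
  rw [abs_mul, abs_of_pos hν0]
  have := Real.abs_cos_le_one q
  nlinarith [abs_nonneg (Real.cos q)]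

theorem contDiff_criticalPrimitive (hν0 : 0 < ν) (hν1 : ν < 1) :
    ContDiff ℝ ∞ (criticalPrimitive ν) := by
  unfold criticalPrimitive
  refine ContDiff.neg (ContDiff.add (Real.contDiff_cos.mul (ContDiff.sqrt (by fun_prop)
    fun q => (critical_radicand_pos hν0 hν1 q).ne')) (ContDiff.div_const ?_ _))
  rw [contDiff_iff_contDiffAt]
  intro q
  have h := abs_lt.1 (abs_mul_cos_lt_one hν0 hν1 q)
  exact ContDiffAt.comp (g := Real.arcsin) q (Real.contDiffAt_arcsin h.1.ne' h.2.ne)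
    (contDiffAt_const.mul Real.contDiff_cos.contDiffAt)

theorem hasDerivAt_criticalPrimitive (hν0 : 0 < ν) (hν1 : ν < 1) (q : ℝ) :
    HasDerivAt (criticalPrimitive ν) (criticalDispersion ν q) q := by
  have hpos := critical_radicand_pos hν0 hν1 q
  have h := abs_lt.1 (abs_mul_cos_lt_one hν0 hν1 q)
  have h1 : HasDerivAt (fun q => 1 - ν ^ 2 * Real.cos q ^ 2)
      (2 * ν ^ 2 * Real.cos q * Real.sin q) q := by
    have := (((Real.hasDerivAt_cos q).pow 2).const_mul (ν ^ 2)).const_sub 1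
    refine this.congr_deriv ?_
    simp
    ring
  have h2 := (Real.hasDerivAt_cos q).mul (h1.sqrt hpos.ne')
  have h3 := ((Real.hasDerivAt_arcsin h.1.ne' h.2.ne).comp q
    ((Real.hasDerivAt_cos q).const_mul ν)).div_const ν
  have h4 := (h2.add h3).neg
  refine h4.congr_deriv ?_
  have hs : √(1 - (ν * Real.cos q) ^ 2) = √(1 - ν ^ 2 * Real.cos q ^ 2) := by rw [mul_pow]
  have hsq := Real.sq_sqrt hpos.le
  have hspos := Real.sqrt_pos.2 hpos
  rw [hs, criticalDispersion]
  set r := √(1 - ν ^ 2 * Real.cos q ^ 2)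
  field_simp
  linear_combination -Real.sin q * hsq

theorem iteratedDeriv_one_criticalPrimitive (hν0 : 0 < ν) (hν1 : ν < 1) :
    iteratedDeriv 1 (criticalPrimitive ν) = criticalDispersion ν := by
  rw [iteratedDeriv_one]
  exact funext fun q => (hasDerivAt_criticalPrimitive hν0 hν1 q).deriv

/-- Where sin q = 0 only the factor sin is differentiated, and cos² q = 1. The slopes at 0 and π
have opposite signs, so their difference does not cancel in the midpoint correction. -/
theorem iteratedDeriv_two_criticalPrimitive (hν0 : 0 < ν) (hν1 : ν < 1) {q : ℝ}
    (hq : Real.sin q = 0) :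
    iteratedDeriv 2 (criticalPrimitive ν) q = 2 * Real.cos q * √(1 - ν ^ 2) := by
  rw [iteratedDeriv_succ, iteratedDeriv_one_criticalPrimitive hν0 hν1]
  have hpos := critical_radicand_pos hν0 hν1 q
  have h1 : DifferentiableAt ℝ (fun q => √(1 - ν ^ 2 * Real.cos q ^ 2)) q :=
    DifferentiableAt.sqrt (by fun_prop) hpos.ne'
  have h2 := ((Real.hasDerivAt_sin q).const_mul 2).mul h1.hasDerivAt
  have h3 := h2.deriv
  have hc : Real.cos q ^ 2 = 1 := by
    have := Real.sin_sq_add_cos_sq q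
    rw [hq] at this
    linarith
  rw [hq, hc, mul_one, mul_zero, zero_mul, add_zero] at h3
  exact h3

/-- The finite-size correction to the free energy at the critical point. -/
theorem tendsto_critical_sum (hν0 : 0 < ν) (hν1 : ν < 1) :
    Tendsto (fun L : ℕ => (L : ℝ) ^ 2 * (1 / (2 * L)
        * ∑ j ∈ Finset.range L, criticalDispersion ν (midpointNode L j)
        - 1 / Real.pi * (Real.arcsin ν / ν + √(1 - ν ^ 2))))
      atTop (𝓝 (Real.pi / 12 * √(1 - ν ^ 2))) := by
  have h1 := (tendsto_midpoint (contDiff_criticalPrimitive hν0 hν1)).const_mul (1 / (2 * Real.pi))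
  rw [iteratedDeriv_one_criticalPrimitive hν0 hν1,
    iteratedDeriv_two_criticalPrimitive hν0 hν1 Real.sin_pi,
    iteratedDeriv_two_criticalPrimitive hν0 hν1 Real.sin_zero, Real.cos_pi, Real.cos_zero] at h1
  have hpi := Real.pi_pos
  have e1 : 1 / (2 * Real.pi) * (-(Real.pi ^ 2 / 24)
      * (2 * -1 * √(1 - ν ^ 2) - 2 * 1 * √(1 - ν ^ 2))) = Real.pi / 12 * √(1 - ν ^ 2) := by
    field_simp
    ring
  have e2 : criticalPrimitive ν Real.pi - criticalPrimitive ν 0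
      = 2 * (Real.arcsin ν / ν + √(1 - ν ^ 2)) := by
    simp only [criticalPrimitive, Real.cos_pi, Real.cos_zero, mul_neg, mul_one, Real.arcsin_neg]
    norm_num
    ring
  rw [e1, e2] at h1
  refine h1.congr fun L => ?_
  by_cases hL : L = 0
  · simp [hL]
  · have hL' : (L : ℝ) ≠ 0 := Nat.cast_ne_zero.2 hL
    field_simp

end Critical

/-! ### The dispersion relation near the critical point -/

/-- The squared quasi-particle energy (times `4`) at `sin² (θ / 2) = σ` and distance `x` from the
critical point. -/
def radicand (ν σ x : ℝ) : ℝ :=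
  ν ^ 2 * (Real.exp x - 1) ^ 2
    + 4 * σ * (1 - ν + ν * Real.exp x - ν ^ 2 * Real.exp x ^ 2 * (1 - σ))

/-- The `n`-th derivative of `radicand ν σ`, for `1 ≤ n`. -/
def radicandDeriv (ν σ : ℝ) (n : ℕ) (x : ℝ) : ℝ :=
  2 * ν ^ 2 * (2 ^ (n - 1) * Real.exp x ^ 2 - Real.exp x)
    + 4 * σ * (ν * Real.exp x - 2 ^ n * ν ^ 2 * Real.exp x ^ 2 * (1 - σ))

/-- The successive derivatives, up to the third one, of the square root of a function `A` with
successive derivatives `A1`, `A2`, `A3`. -/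
def sqrtJet (A A1 A2 A3 : ℝ → ℝ) : ℕ → ℝ → ℝ
  | 0, x => √(A x)
  | 1, x => A1 x / (2 * √(A x))
  | 2, x => A2 x / (2 * √(A x)) - A1 x ^ 2 / (4 * √(A x) ^ 3)
  | _, x => A3 x / (2 * √(A x)) - 3 * A1 x * A2 x / (4 * √(A x) ^ 3)
      + 3 * A1 x ^ 3 / (8 * √(A x) ^ 5)

theorem hasDerivAt_sqrtJet {A A1 A2 A3 : ℝ → ℝ} {x : ℝ} (hA : 0 < A x)
    (h0 : HasDerivAt A (A1 x) x) (h1 : HasDerivAt A1 (A2 x) x) (h2 : HasDerivAt A2 (A3 x) x)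
    {k : ℕ} (hk : k < 3) :
    HasDerivAt (sqrtJet A A1 A2 A3 k) (sqrtJet A A1 A2 A3 (k + 1) x) x := by
  have hs : 0 < √(A x) := Real.sqrt_pos.2 hA
  have hd := h0.sqrt hA.ne'
  interval_cases k
  · exact hd
  · refine (h1.fun_div (hd.const_mul 2) (by positivity)).congr_deriv ?_
    simp only [sqrtJet]
    field_simp
    ring
  · refine ((h2.fun_div (hd.const_mul 2) (by positivity)).fun_sub
      ((h1.fun_pow 2).fun_div ((hd.fun_pow 3).const_mul 4) (by positivity))).congr_deriv ?_
    simp only [sqrtJet]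
    field_simp
    ring

/-- The dispersion relation and its derivatives at distance `x` from the critical point. -/
def dispersionJet (ν σ : ℝ) : ℕ → ℝ → ℝ :=
  sqrtJet (radicand ν σ) (radicandDeriv ν σ 1) (radicandDeriv ν σ 2) (radicandDeriv ν σ 3)

/-- The remainder of the second-order expansion of the dispersion relation. -/
def dispersionRemainder (ν σ x : ℝ) : ℝ :=
  dispersionJet ν σ 0 x - dispersionJet ν σ 0 0 - x * dispersionJet ν σ 1 0
    - x ^ 2 / 2 * dispersionJet ν σ 2 0

theorem hasDerivAt_radicand (ν σ x : ℝ) :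
    HasDerivAt (radicand ν σ) (radicandDeriv ν σ 1 x) x := by
  have he := Real.hasDerivAt_exp x
  have h := (((he.sub_const 1).fun_pow 2).const_mul (ν ^ 2)).fun_add
    (((he.const_mul ν).const_add (1 - ν)).fun_sub
      (((he.fun_pow 2).const_mul (ν ^ 2)).mul_const (1 - σ)) |>.const_mul (4 * σ))
  refine h.congr_deriv ?_
  simp only [radicandDeriv]
  norm_num
  ring

theorem hasDerivAt_radicandDeriv (ν σ x : ℝ) {n : ℕ} (hn : 1 ≤ n) :
    HasDerivAt (radicandDeriv ν σ n) (radicandDeriv ν σ (n + 1) x) x := by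
  obtain ⟨m, rfl⟩ := Nat.exists_eq_add_of_le' hn
  have he := Real.hasDerivAt_exp x
  have h := ((((he.fun_pow 2).const_mul (2 ^ (m + 1 - 1) : ℝ)).fun_sub he).const_mul
    (2 * ν ^ 2)).fun_add (((he.const_mul ν).fun_sub
      (((he.fun_pow 2).const_mul (2 ^ (m + 1) * ν ^ 2)).mul_const (1 - σ))).const_mul (4 * σ))
  refine h.congr_deriv ?_
  simp only [radicandDeriv, Nat.add_sub_cancel]
  norm_num [pow_succ]
  ring

/-! ### Bounds on the dispersion relation, uniform in the momentum -/

section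

variable {ν : ℝ}

/-- With 1 − 2σ = cos θ and 4σ(1 − σ) = sin² θ this is the sum of the kinetic and pairing parts of
4E², which shows positivity. The form in the definition shows instead how it closes at x = 0, σ = 0.
-/
theorem radicand_eq (ν σ x : ℝ) : radicand ν σ x
    = ((1 - ν + ν * Real.exp x) * (1 - 2 * σ) - 1) ^ 2
      + (1 - ν) * (1 - ν + 2 * ν * Real.exp x) * (4 * σ * (1 - σ)) := by
  rw [radicand]
  ring

theorem radicand_pos (hν0 : 0 < ν) (hν1 : ν < 1) {σ : ℝ} (hσ0 : 0 < σ) (hσ1 : σ ≤ 1) (x : ℝ) :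
    0 < radicand ν σ x := by
  have he := Real.exp_pos x
  have h1 : 0 < 1 - ν := by linarith
  rw [radicand_eq]
  rcases hσ1.lt_or_eq with h | h
  · have : 0 < 1 - σ := by linarith
    positivity
  · have h2 : 0 < ν * Real.exp x := by positivity
    rw [h]
    nlinarith

theorem hasDerivAt_dispersionJet (hν0 : 0 < ν) (hν1 : ν < 1) {σ : ℝ} (hσ0 : 0 < σ) (hσ1 : σ ≤ 1)
    (x : ℝ) {k : ℕ} (hk : k < 3) :
    HasDerivAt (dispersionJet ν σ k) (dispersionJet ν σ (k + 1) x) x :=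
  hasDerivAt_sqrtJet (radicand_pos hν0 hν1 hσ0 hσ1 x) (hasDerivAt_radicand ν σ x)
    (hasDerivAt_radicandDeriv ν σ x le_rfl) (hasDerivAt_radicandDeriv ν σ x one_le_two) hk

/-- The bound |A′| ≤ K√A trades every factor A′ for √A. The terms of the third derivative, with up
to five inverse powers of √A, are then all of order 1/A. -/
theorem abs_sqrtJet_three_le {A A1 A2 A3 : ℝ → ℝ} {x K M R : ℝ} (hr : 0 < √(A x))
    (hR : √(A x) ≤ R) (h1 : |A1 x| ≤ K * √(A x)) (h2 : |A2 x| ≤ M) (h3 : |A3 x| ≤ M) :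
    |sqrtJet A A1 A2 A3 3 x| ≤ (M * R + 3 * K * M + 3 * K ^ 3) / √(A x) ^ 2 := by
  set r := √(A x) with hrdef
  have hM : 0 ≤ M := (abs_nonneg _).trans h2
  have hK : 0 ≤ K := by
    by_contra h
    push Not at h
    nlinarith [abs_nonneg (A1 x)]
  have e1 : |A3 x / (2 * r)| ≤ M * R / r ^ 2 := by
    rw [abs_div, abs_of_pos (by positivity : 0 < 2 * r), div_le_div_iff₀ (by positivity)
      (by positivity)]
    have : |A3 x| * r ≤ M * R := mul_le_mul h3 hR hr.le hM
    nlinarith [mul_le_mul_of_nonneg_right this hr.le, mul_nonneg (mul_nonneg hM (hr.le.trans hR)) hr.le]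
  have e2 : |3 * A1 x * A2 x / (4 * r ^ 3)| ≤ 3 * K * M / r ^ 2 := by
    rw [abs_div, abs_of_pos (by positivity : 0 < 4 * r ^ 3), div_le_div_iff₀ (by positivity)
      (by positivity), abs_mul, abs_mul, abs_of_pos (by norm_num : (0 : ℝ) < 3)]
    have : |A1 x| * |A2 x| ≤ K * r * M := mul_le_mul h1 h2 (abs_nonneg _) (by positivity)
    nlinarith [mul_le_mul_of_nonneg_right this (by positivity : 0 ≤ r ^ 2),
      (by positivity : 0 ≤ K * M * r ^ 3)]
  have e3 : |3 * A1 x ^ 3 / (8 * r ^ 5)| ≤ 3 * K ^ 3 / r ^ 2 := by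
    rw [abs_div, abs_of_pos (by positivity : 0 < 8 * r ^ 5), abs_mul, abs_pow,
      abs_of_pos (by norm_num : (0 : ℝ) < 3)]
    have hp : |A1 x| ^ 3 ≤ (K * r) ^ 3 := pow_le_pow_left₀ (abs_nonneg _) h1 3
    calc 3 * |A1 x| ^ 3 / (8 * r ^ 5) ≤ 3 * (K * r) ^ 3 / (8 * r ^ 5) := by gcongr
      _ = 3 * K ^ 3 / r ^ 2 / 8 := by field_simp
      _ ≤ 3 * K ^ 3 / r ^ 2 := div_le_self (by positivity) (by norm_num)
  simp only [sqrtJet]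
  have := abs_add_le (A3 x / (2 * r) - 3 * A1 x * A2 x / (4 * r ^ 3)) (3 * A1 x ^ 3 / (8 * r ^ 5))
  have := abs_sub (A3 x / (2 * r)) (3 * A1 x * A2 x / (4 * r ^ 3))
  rw [add_div, add_div]
  linarith

theorem radicandDeriv_bounds (hν0 : 0 < ν) (hν1 : ν < 1) {σ x : ℝ} (hσ0 : 0 < σ) (hσ1 : σ ≤ 1)
    (hx : Real.exp x < 2) :
    ν * Real.exp x ≤ 2 ∧ 0 ≤ ν ^ 2 * Real.exp x ^ 2 * (1 - σ) ∧
      ν ^ 2 * Real.exp x ^ 2 * (1 - σ) ≤ 4 := by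
  have hy0 := Real.exp_pos x
  have hνy : ν * Real.exp x ≤ 2 := by nlinarith
  have h0 : 0 < ν * Real.exp x := by positivity
  have hsq : ν ^ 2 * Real.exp x ^ 2 ≤ 4 := by nlinarith
  exact ⟨hνy, mul_nonneg (by positivity) (by linarith),
    (mul_le_of_le_one_right (by positivity) (by linarith)).trans hsq⟩

theorem abs_radicandDeriv_one_le (hν0 : 0 < ν) (hν1 : ν < 1) {σ x : ℝ} (hσ0 : 0 < σ)
    (hσ1 : σ ≤ 1) (hx : Real.exp x < 2) :
    |radicandDeriv ν σ 1 x| ≤ 4 * |ν * (Real.exp x - 1)| + 32 * σ := by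
  obtain ⟨h1, h2, h3⟩ := radicandDeriv_bounds hν0 hν1 hσ0 hσ1 hx
  have hy0 := Real.exp_pos x
  have e : radicandDeriv ν σ 1 x = 2 * (ν * Real.exp x) * (ν * (Real.exp x - 1))
      + 4 * σ * (ν * Real.exp x - 2 * (ν ^ 2 * Real.exp x ^ 2 * (1 - σ))) := by
    rw [radicandDeriv]
    norm_num
    ring
  have h0 : 0 < ν * Real.exp x := by positivity
  rw [e]
  generalize ν ^ 2 * Real.exp x ^ 2 * (1 - σ) = q at *
  generalize ν * (Real.exp x - 1) = d at *
  generalize ν * Real.exp x = z at *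
  have e1 : |2 * z * d| ≤ 4 * |d| := by
    rw [abs_mul, abs_of_pos (by positivity)]
    exact mul_le_mul_of_nonneg_right (by linarith) (abs_nonneg _)
  have e2 : |4 * σ * (z - 2 * q)| ≤ 4 * σ * 8 := by
    rw [abs_mul, abs_of_pos (by positivity)]
    refine mul_le_mul_of_nonneg_left (abs_le.2 ⟨?_, ?_⟩) (by positivity) <;> linarith
  refine (abs_add_le _ _).trans ((add_le_add e1 e2).trans (le_of_eq ?_))
  ring

theorem abs_radicandDeriv_le (hν0 : 0 < ν) (hν1 : ν < 1) {σ x : ℝ} (hσ0 : 0 < σ)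
    (hσ1 : σ ≤ 1) (hx : Real.exp x < 2) {n : ℕ} (hn : 1 ≤ n) (hn' : n ≤ 3) :
    |radicandDeriv ν σ n x| ≤ 200 := by
  obtain ⟨h1, h2, h3⟩ := radicandDeriv_bounds hν0 hν1 hσ0 hσ1 hx
  have hy0 := Real.exp_pos x
  have hz0 : 0 < ν * Real.exp x := by positivity
  have hy2 : Real.exp x ^ 2 ≤ 4 := by nlinarith
  obtain ⟨m, rfl⟩ := Nat.exists_eq_add_of_le' hn
  have hp : (2 : ℝ) ^ m ≤ 4 := by
    calc (2 : ℝ) ^ m ≤ 2 ^ 2 := pow_le_pow_right₀ (by norm_num) (by omega)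
      _ = 4 := by norm_num
  have hp0 : (0 : ℝ) < 2 ^ m := by positivity
  have e : radicandDeriv ν σ (m + 1) x = 2 * ν ^ 2 * (2 ^ m * Real.exp x ^ 2 - Real.exp x)
      + 4 * σ * (ν * Real.exp x - 2 * (2 ^ m * (ν ^ 2 * Real.exp x ^ 2 * (1 - σ)))) := by
    rw [radicandDeriv, Nat.add_sub_cancel, pow_succ]
    ring
  have a1 := mul_le_mul hp hy2 (by positivity) (by norm_num : (0 : ℝ) ≤ 4)
  have a2 := mul_le_mul hp h3 h2 (by norm_num : (0 : ℝ) ≤ 4)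
  have a3 : 0 ≤ (2 : ℝ) ^ m * Real.exp x ^ 2 := by positivity
  have a4 := mul_nonneg hp0.le h2
  have hν2 : 2 * ν ^ 2 ≤ 2 := by nlinarith
  rw [e]
  generalize (2 : ℝ) ^ m * (ν ^ 2 * Real.exp x ^ 2 * (1 - σ)) = q at *
  generalize (2 : ℝ) ^ m * Real.exp x ^ 2 = p at *
  have e1 : |2 * ν ^ 2 * (p - Real.exp x)| ≤ 2 * 18 := by
    rw [abs_mul, abs_of_nonneg (by positivity)]
    refine mul_le_mul hν2 (abs_le.2 ⟨?_, ?_⟩) (abs_nonneg _) (by norm_num) <;> linarith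
  have e2 : |4 * σ * (ν * Real.exp x - 2 * q)| ≤ 4 * 34 := by
    rw [abs_mul, abs_of_pos (by positivity)]
    refine mul_le_mul (by linarith) (abs_le.2 ⟨?_, ?_⟩) (abs_nonneg _) (by norm_num) <;> linarith
  exact (abs_add_le _ _).trans ((add_le_add e1 e2).trans (by norm_num))

/-- Near x = 0 one has A ≥ (ν(eˣ − 1))² + κσ, so √A controls |ν(eˣ − 1)| and, since √A ≤ 4, also σ.
Hence |A′| ≤ K√A uniformly in σ, and the third derivative is of order 1/A ≤ 1/(κσ). -/
theorem exists_abs_dispersionJet_three_le (hν0 : 0 < ν) (hν1 : ν < 1) :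
    ∃ C x₀ : ℝ, 0 < x₀ ∧ ∀ σ x : ℝ, 0 < σ → σ ≤ 1 → |x| ≤ x₀ →
      |dispersionJet ν σ 3 x| ≤ C / σ := by
  have hgap : 0 < 1 - ν ^ 2 := by nlinarith
  -- At x = 0 the expression equals 1 − ν². Half of it survives nearby, and 4σ times that half is
  -- κσ.
  have hcont : ∀ᶠ x in 𝓝 (0 : ℝ), (1 - ν ^ 2) / 2 < 1 - ν + ν * Real.exp x - ν ^ 2 * Real.exp x ^ 2
      ∧ Real.exp x < 2 := by
    refine Filter.Eventually.and ?_ ?_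
    · refine ContinuousAt.eventually_lt continuousAt_const (by fun_prop) ?_
      simp only [Real.exp_zero]
      linarith
    · refine ContinuousAt.eventually_lt (by fun_prop) continuousAt_const ?_
      simp
  obtain ⟨ε, hε, hball⟩ := Metric.eventually_nhds_iff.1 hcont
  set κ := 2 * (1 - ν ^ 2) with hκ
  have hκ0 : 0 < κ := by positivity
  set K := 4 + 128 / κ with hK
  refine ⟨(200 * 4 + 3 * K * 200 + 3 * K ^ 3) / κ, ε / 2, by positivity, ?_⟩
  intro σ x hσ0 hσ1 hx
  obtain ⟨hb1, hb2⟩ := hball (show dist x 0 < ε by rw [Real.dist_eq, sub_zero]; linarith)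
  have hy0 := Real.exp_pos x
  set y := Real.exp x with hy
  have hA := radicand_pos hν0 hν1 hσ0 hσ1 x
  set r := √(radicand ν σ x) with hr
  have hr0 : 0 < r := Real.sqrt_pos.2 hA
  have hr2 : r ^ 2 = radicand ν σ x := Real.sq_sqrt hA.le
  have hAeq : radicand ν σ x = (ν * (y - 1)) ^ 2
      + 4 * σ * (1 - ν + ν * y - ν ^ 2 * y ^ 2) + 4 * (ν * y * σ) ^ 2 := by
    rw [radicand]
    ring
  have hlow : (ν * (y - 1)) ^ 2 + κ * σ ≤ r ^ 2 := by
    rw [hr2, hAeq, hκ]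
    nlinarith [sq_nonneg (ν * y * σ)]
  have hνy : ν * y ≤ 2 := by nlinarith
  have hνy0 : 0 < ν * y := by positivity
  have hνy2 : ν ^ 2 * y ^ 2 ≤ 4 := by nlinarith
  have hup : r ≤ 4 := by
    refine Real.sqrt_le_iff.2 ⟨by norm_num, ?_⟩
    rw [radicand]
    have h1 : ν ^ 2 * (y - 1) ^ 2 ≤ 1 := by
      have : (y - 1) ^ 2 ≤ 1 := by nlinarith
      nlinarith [sq_nonneg ν, sq_nonneg (y - 1)]
    have h2 : 1 - ν + ν * y - ν ^ 2 * y ^ 2 * (1 - σ) ≤ 3 := by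
      have : 0 ≤ ν ^ 2 * y ^ 2 * (1 - σ) := mul_nonneg (by positivity) (by linarith)
      linarith
    nlinarith
  have hd : |ν * (y - 1)| ≤ r := by
    refine abs_le_of_sq_le_sq ?_ hr0.le
    nlinarith [mul_pos hκ0 hσ0]
  have hσr : σ ≤ 4 / κ * r := by
    rw [div_mul_eq_mul_div, le_div_iff₀ hκ0]
    nlinarith [sq_nonneg (ν * (y - 1))]
  have h1 : |radicandDeriv ν σ 1 x| ≤ K * r := by
    refine (abs_radicandDeriv_one_le hν0 hν1 hσ0 hσ1 hb2).trans ?_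
    calc 4 * |ν * (y - 1)| + 32 * σ ≤ 4 * r + 32 * (4 / κ * r) := by gcongr
      _ = K * r := by
        rw [hK]
        ring
  have h2 : |radicandDeriv ν σ 2 x| ≤ 200 :=
    abs_radicandDeriv_le hν0 hν1 hσ0 hσ1 hb2 (by norm_num) (by norm_num)
  have h3 : |radicandDeriv ν σ 3 x| ≤ 200 :=
    abs_radicandDeriv_le hν0 hν1 hσ0 hσ1 hb2 (by norm_num) (by norm_num)
  have h4 := abs_sqrtJet_three_le hr0 hup h1 h2 h3
  refine h4.trans ?_
  rw [div_div]
  refine div_le_div_of_nonneg_left (by positivity) (by positivity) ?_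
  nlinarith [sq_nonneg (ν * (y - 1))]

theorem exists_abs_dispersionRemainder_le (hν0 : 0 < ν) (hν1 : ν < 1) :
    ∃ C x₀ : ℝ, 0 ≤ C ∧ 0 < x₀ ∧ ∀ σ x : ℝ, 0 < σ → σ ≤ 1 → |x| ≤ x₀ →
      |dispersionRemainder ν σ x| ≤ C / σ * |x| ^ 3 := by
  obtain ⟨C, x₀, hx₀, h⟩ := exists_abs_dispersionJet_three_le hν0 hν1
  have hC : 0 ≤ C := by
    have := (abs_nonneg _).trans (h 1 0 one_pos le_rfl (by simpa using hx₀.le))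
    simpa using this
  refine ⟨C, x₀, hC, hx₀, fun σ x hσ0 hσ1 hx => ?_⟩
  have h1 := abs_sub_taylor_le (B := C / σ) 3 (dispersionJet ν σ) 0 x
    (fun k hk t _ => hasDerivAt_dispersionJet hν0 hν1 hσ0 hσ1 t hk)
    (fun t ht => h σ t hσ0 hσ1 (by
      rw [sub_zero, sub_zero] at ht
      exact ht.trans hx))
  rw [sub_zero] at h1
  refine le_trans (le_of_eq ?_) h1
  congr 1
  simp only [dispersionRemainder, Finset.sum_range_succ, Finset.sum_range_zero, Nat.factorial]
  norm_num
  ring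

end

/-! ### The scaling limit of the second-order remainder -/

/-- The value of `sin² (θ / 2)` at the `j`-th antiperiodic momentum. -/
def nodeWeight (L j : ℕ) : ℝ := Real.sin (midpointNode L j) ^ 2

theorem tendsto_mul_of_hasDerivAt {f : ℝ → ℝ} {f' : ℝ} (hf : HasDerivAt f f' 0) (h0 : f 0 = 0)
    (c : ℝ) : Tendsto (fun L : ℕ => (L : ℝ) * f (c / L)) atTop (𝓝 (f' * c)) := by
  have h1 : HasDerivAt (fun t => f (c * t)) (f' * c) 0 := by
    have h2 : HasDerivAt (fun t : ℝ => c * t) c 0 := by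
      simpa using (hasDerivAt_id (0 : ℝ)).const_mul c
    have h3 : HasDerivAt f f' (c * 0) := by simpa using hf
    exact h3.comp 0 h2
  have h4 := h1.tendsto_slope_zero
  have h5 : Tendsto (fun L : ℕ => (L : ℝ)⁻¹) atTop (𝓝[≠] 0) := by
    refine tendsto_nhdsWithin_iff.2 ⟨tendsto_inv_atTop_nhds_zero_nat, ?_⟩
    filter_upwards [eventually_gt_atTop 0] with L hL
    simpa using hL.ne'
  refine (h4.comp h5).congr fun L => ?_
  simp [h0, div_eq_mul_inv]

theorem tendsto_mul_sin_node (j : ℕ) :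
    Tendsto (fun L : ℕ => (L : ℝ) * Real.sin (midpointNode L j)) atTop
      (𝓝 (Real.pi * (2 * j + 1) / 2)) := by
  have h := tendsto_mul_of_hasDerivAt (Real.hasDerivAt_sin 0) Real.sin_zero
    (Real.pi * (2 * j + 1) / 2)
  rw [Real.cos_zero, one_mul] at h
  refine h.congr fun L => ?_
  rw [midpointNode, div_div]

theorem tendsto_nodeWeight (j : ℕ) : Tendsto (fun L : ℕ => nodeWeight L j) atTop (𝓝 0) := by
  have h := (tendsto_mul_sin_node j).mul tendsto_inv_atTop_nhds_zero_nat
  have h2 := h.pow 2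
  rw [mul_zero, zero_pow two_ne_zero] at h2
  refine h2.congr' ?_
  filter_upwards [eventually_gt_atTop 0] with L hL
  have : (L : ℝ) ≠ 0 := Nat.cast_ne_zero.2 hL.ne'
  rw [nodeWeight]
  field_simp

theorem tendsto_sq_mul_nodeWeight (j : ℕ) :
    Tendsto (fun L : ℕ => (L : ℝ) ^ 2 * nodeWeight L j) atTop
      (𝓝 ((Real.pi * (2 * j + 1) / 2) ^ 2)) := by
  refine ((tendsto_mul_sin_node j).pow 2).congr fun L => ?_
  rw [nodeWeight, mul_pow]

theorem tendsto_div_nat (v : ℝ) : Tendsto (fun L : ℕ => v / (L : ℝ)) atTop (𝓝 0) :=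
  tendsto_const_div_atTop_nhds_zero_nat v

/-- On the scale 1/L both eˣ − 1 ≈ v/L and √σ ≈ π(2j + 1)/(2L) enter at the same order, which leaves
a relativistic dispersion with mass proportional to v. -/
theorem tendsto_mul_dispersion (ν v : ℝ) (j : ℕ) :
    Tendsto (fun L : ℕ => (L : ℝ) * dispersionJet ν (nodeWeight L j) 0 (v / L)) atTop
      (𝓝 (√(ν ^ 2 * v ^ 2 + (1 - ν ^ 2) * (Real.pi * (2 * j + 1)) ^ 2))) := by
  have hσ := tendsto_nodeWeight j
  have hσ2 := tendsto_sq_mul_nodeWeight j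
  have hy : Tendsto (fun L : ℕ => Real.exp (v / L)) atTop (𝓝 1) := by
    have := (Real.continuous_exp.tendsto 0).comp (tendsto_div_nat v)
    rwa [Real.exp_zero] at this
  have he : Tendsto (fun L : ℕ => (L : ℝ) * (Real.exp (v / L) - 1)) atTop (𝓝 v) := by
    have h := tendsto_mul_of_hasDerivAt (f := fun x => Real.exp x - 1)
      ((Real.hasDerivAt_exp 0).sub_const 1) (by simp) v
    simpa using h
  have h1 := ((he.pow 2).const_mul (ν ^ 2)).add ((hσ2.const_mul 4).mul
    (((hy.const_mul ν).const_add (1 - ν)).sub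
      (((hy.pow 2).const_mul (ν ^ 2)).mul (hσ.const_sub 1))))
  have h2 := h1.sqrt
  have e : ν ^ 2 * v ^ 2 + 4 * (Real.pi * (2 * j + 1) / 2) ^ 2
      * (1 - ν + ν * 1 - ν ^ 2 * 1 ^ 2 * (1 - 0))
      = ν ^ 2 * v ^ 2 + (1 - ν ^ 2) * (Real.pi * (2 * j + 1)) ^ 2 := by ring
  rw [e] at h2
  refine h2.congr fun L => ?_
  have h3 : ν ^ 2 * ((L : ℝ) * (Real.exp (v / L) - 1)) ^ 2 + 4 * ((L : ℝ) ^ 2 * nodeWeight L j)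
      * (1 - ν + ν * Real.exp (v / L) - ν ^ 2 * Real.exp (v / L) ^ 2 * (1 - nodeWeight L j))
      = (L : ℝ) ^ 2 * radicand ν (nodeWeight L j) (v / L) := by
    rw [radicand]
    ring
  rw [h3, Real.sqrt_mul (by positivity), Real.sqrt_sq (Nat.cast_nonneg L)]
  rfl

section

variable {ν : ℝ}

/-- Taking √(1 − ν²) = 1/ξ out of the root rescales u² by ν²/(1 − ν²) = ξ² − 1. -/
theorem sqrt_mul_scalingTerm (hν0 : 0 < ν) (hν1 : ν < 1) (u : ℝ) (j : ℕ) :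
    √(ν ^ 2 * u ^ 2 + (1 - ν ^ 2) * (Real.pi * (2 * j + 1)) ^ 2)
        - √(1 - ν ^ 2) * (Real.pi * (2 * j + 1))
        - u ^ 2 / 2 * (2 * ν ^ 2 / (2 * (√(1 - ν ^ 2) * (Real.pi * (2 * j + 1)))))
      = √(1 - ν ^ 2) * scalingTerm (√(soundVelocity ν ^ 2 - 1) * u) j := by
  have hgap : 0 < 1 - ν ^ 2 := by nlinarith
  have hs := Real.sqrt_pos.2 hgap
  have hs2 := Real.sq_sqrt hgap.le
  have hp : 0 < Real.pi * (2 * j + 1) := by have := Real.pi_pos; positivity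
  have hξ : soundVelocity ν ^ 2 - 1 = ν ^ 2 / (1 - ν ^ 2) := by
    rw [soundVelocity, div_pow, hs2]
    field_simp
    ring
  have hξ2 : (√(soundVelocity ν ^ 2 - 1) * u) ^ 2 = ν ^ 2 / (1 - ν ^ 2) * u ^ 2 := by
    rw [mul_pow, Real.sq_sqrt (by rw [hξ]; positivity), hξ]
  have h1 : √(1 - ν ^ 2) * √(ν ^ 2 / (1 - ν ^ 2) * u ^ 2 + Real.pi ^ 2 * (2 * j + 1) ^ 2)
      = √(ν ^ 2 * u ^ 2 + (1 - ν ^ 2) * (Real.pi * (2 * j + 1)) ^ 2) := by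
    rw [← Real.sqrt_mul hgap.le]
    congr 1
    field_simp
  rw [scalingTerm, hξ2, mul_sub, mul_sub, h1]
  congr 1
  rw [← hs2] at *
  set s := √(1 - ν ^ 2)
  rw [Real.sqrt_sq hs.le]
  field_simp

theorem tendsto_mul_dispersionRemainder (hν0 : 0 < ν) (hν1 : ν < 1) (u : ℝ) (j : ℕ) :
    Tendsto (fun L : ℕ => (L : ℝ) * dispersionRemainder ν (nodeWeight L j) (u / L)) atTop
      (𝓝 (√(1 - ν ^ 2) * scalingTerm (√(soundVelocity ν ^ 2 - 1) * u) j)) := by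
  have hgap : 0 < 1 - ν ^ 2 := by nlinarith
  have hs := Real.sqrt_pos.2 hgap
  have hp : 0 < Real.pi * (2 * (j : ℝ) + 1) := by have := Real.pi_pos; positivity
  have hσ := tendsto_nodeWeight j
  have hσ2 := tendsto_sq_mul_nodeWeight j
  have hinv := tendsto_inv_atTop_nhds_zero_nat (𝕜 := ℝ)
  have t0 := tendsto_mul_dispersion ν u j
  have t1 := tendsto_mul_dispersion ν 0 j
  have e1 : √(ν ^ 2 * 0 ^ 2 + (1 - ν ^ 2) * (Real.pi * (2 * (j : ℝ) + 1)) ^ 2)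
      = √(1 - ν ^ 2) * (Real.pi * (2 * j + 1)) := by
    rw [zero_pow two_ne_zero, mul_zero, zero_add, Real.sqrt_mul hgap.le, Real.sqrt_sq hp.le]
  simp only [zero_div] at t1
  rw [e1] at t1
  set P := √(1 - ν ^ 2) * (Real.pi * (2 * (j : ℝ) + 1)) with hP
  have hP0 : P ≠ 0 := by positivity
  -- At x = 0 the derivative A′ is of order σ, that is L⁻². The linear term and the A′² part of the
  -- quadratic one therefore vanish in the limit; A″ → 2ν² survives and gives the counterterm in
  -- `scalingTerm`.
  have t2 : Tendsto (fun L : ℕ => (L : ℝ) ^ 2 * radicandDeriv ν (nodeWeight L j) 1 0) atTop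
      (𝓝 (4 * (Real.pi * (2 * j + 1) / 2) ^ 2 * (ν - 2 * ν ^ 2 * (1 - 0)))) := by
    refine ((hσ2.const_mul 4).mul (((hσ.const_sub 1).const_mul (2 * ν ^ 2)).const_sub ν)).congr
      fun L => ?_
    simp only [radicandDeriv, Real.exp_zero]
    norm_num
    ring
  have t3 : Tendsto (fun L : ℕ => radicandDeriv ν (nodeWeight L j) 2 0) atTop
      (𝓝 (2 * ν ^ 2)) := by
    have h := ((hσ.const_mul 4).mul (((hσ.const_sub 1).const_mul (4 * ν ^ 2)).const_sub ν)).const_add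
      (2 * ν ^ 2)
    rw [mul_zero, zero_mul, add_zero] at h
    refine h.congr fun L => ?_
    simp only [radicandDeriv, Real.exp_zero]
    norm_num
  have t4 := ((t2.div (t1.const_mul 2) (by positivity)).mul hinv).const_mul u
  have t5 := ((t3.div (t1.const_mul 2) (by positivity)).sub
    (((t2.pow 2).div ((t1.pow 3).const_mul 4) (by positivity)).mul (hinv.pow 2))).const_mul
      (u ^ 2 / 2)
  have t6 := ((t0.sub t1).sub t4).sub t5
  rw [mul_zero, mul_zero, sub_zero, zero_pow two_ne_zero, mul_zero, sub_zero,
    sqrt_mul_scalingTerm hν0 hν1] at t6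
  refine t6.congr' ?_
  filter_upwards [eventually_gt_atTop 0] with L hL
  have hL' : (L : ℝ) ≠ 0 := Nat.cast_ne_zero.2 hL.ne'
  simp only [dispersionRemainder, dispersionJet, sqrtJet, Pi.div_apply]
  -- Division by zero gives zero, so the two expressions agree in this case as well and no
  -- positivity is needed.
  by_cases hr : √(radicand ν (nodeWeight L j) 0) = 0
  · rw [hr]
    simp
  · field_simp

/-! ### Summability of the scaling series and dominated convergence over the modes -/

theorem summable_odd_sq : Summable fun j : ℕ => 1 / (2 * (j : ℝ) + 1) ^ 2 := by
  have h := (Real.summable_one_div_nat_pow.2 one_lt_two).comp_injective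
    (i := fun j : ℕ => 2 * j + 1) fun a b hab => by simpa using hab
  refine h.congr fun j => ?_
  simp

theorem summable_scalingTerm (u : ℝ) : Summable (scalingTerm u) := by
  refine Summable.of_norm_bounded (summable_odd_sq.mul_left (u ^ 4)) fun j => ?_
  have hpi := Real.pi_gt_three
  set n : ℝ := 2 * j + 1 with hn
  have hn1 : 1 ≤ n := by
    have : (0 : ℝ) ≤ j := Nat.cast_nonneg j
    linarith
  set p := Real.pi * n with hp
  have hpn : n ≤ p := by nlinarith
  have hp0 : 0 < p := by positivity
  set r := √(u ^ 2 + p ^ 2) with hr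
  have hr2 : r ^ 2 = u ^ 2 + p ^ 2 := Real.sq_sqrt (by positivity)
  have hrp : p ≤ r := Real.le_sqrt_of_sq_le (by nlinarith [sq_nonneg u])
  -- Rationalising √(u² + p²) − p twice gives an exact expression of order p⁻³; a majorant of order
  -- n⁻² is enough.
  have e : scalingTerm u j = -(u ^ 4 / (2 * p * (r + p) ^ 2)) := by
    have h1 : scalingTerm u j = r - p - u ^ 2 / (2 * p) := by
      rw [scalingTerm, hr, hp, mul_pow, mul_assoc 2]
    rw [h1, eq_neg_iff_add_eq_zero]
    have h2 : 0 < r + p := by linarith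
    have hu : u ^ 2 = r ^ 2 - p ^ 2 := by linarith
    rw [show u ^ 4 = (u ^ 2) ^ 2 by ring, hu]
    field_simp
    ring
  rw [Real.norm_eq_abs, e, abs_neg, abs_of_nonneg (by positivity), mul_one_div]
  refine div_le_div_of_nonneg_left (by positivity) (by positivity) ?_
  nlinarith [mul_le_mul hpn hpn (by linarith) hp0.le, mul_pos hp0 hp0]

/-- Folds j with L − 1 − j: the lower half counts twice, the middle mode of an odd L once, the upper
half not at all. The soft modes then all sit near j = 0, and each fixed j has weight 2 for large L.
-/
theorem sum_eq_sum_weighted {L : ℕ} {g : ℕ → ℝ} (hg : ∀ j < L, g (L - 1 - j) = g j) :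
    ∑ j ∈ Finset.range L, g j
      = ∑ j ∈ Finset.range L,
          (if 2 * j + 1 < L then 2 else if 2 * j + 1 = L then 1 else 0) * g j := by
  set c : ℕ → ℝ := fun j => if 2 * j + 1 < L then 2 else if 2 * j + 1 = L then 1 else 0 with hc
  have h1 := Finset.sum_range_reflect (fun j => c j * g j) L
  have h2 : ∑ j ∈ Finset.range L, (c (L - 1 - j) * g (L - 1 - j) + c j * g j)
      = ∑ j ∈ Finset.range L, 2 * g j := by
    refine Finset.sum_congr rfl fun j hj => ?_
    have hj' := Finset.mem_range.1 hj
    rw [hg j hj', ← add_mul]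
    congr 1
    simp only [hc]
    split_ifs <;> first | omega | norm_num
  rw [Finset.sum_add_distrib, h1, ← Finset.mul_sum] at h2
  linarith

theorem nodeWeight_reflect {L j : ℕ} (hj : j < L) : nodeWeight L (L - 1 - j) = nodeWeight L j := by
  have hL : (L : ℝ) ≠ 0 := Nat.cast_ne_zero.2 (by omega)
  have h : midpointNode L (L - 1 - j) = Real.pi - midpointNode L j := by
    rw [midpointNode, midpointNode, Nat.cast_sub (by omega), Nat.cast_sub (by omega)]
    push_cast
    field_simp
    ring
  rw [nodeWeight, h, Real.sin_pi_sub, nodeWeight]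

theorem sin_midpointNode_pos {L j : ℕ} (hj : j < L) : 0 < Real.sin (midpointNode L j) := by
  have hL : (0 : ℝ) < L := Nat.cast_pos.2 (by omega)
  have hpi := Real.pi_pos
  refine Real.sin_pos_of_pos_of_lt_pi (by unfold midpointNode; positivity) ?_
  rw [midpointNode, div_lt_iff₀ (by positivity)]
  have : (j : ℝ) + 1 ≤ L := by exact_mod_cast hj
  nlinarith

theorem nodeWeight_pos {L j : ℕ} (hj : j < L) : 0 < nodeWeight L j :=
  pow_pos (sin_midpointNode_pos hj) 2

theorem nodeWeight_le_one (L j : ℕ) : nodeWeight L j ≤ 1 := Real.sin_sq_le_one _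

/-- Jordan's inequality sin x ≥ 2x/π, available on the lower half of the nodes. -/
theorem le_nodeWeight {L j : ℕ} (hj : 2 * j + 1 ≤ L) :
    ((2 * (j : ℝ) + 1) / L) ^ 2 ≤ nodeWeight L j := by
  have hL : (0 : ℝ) < L := Nat.cast_pos.2 (by omega)
  have hpi := Real.pi_pos
  have hle : (2 * (j : ℝ) + 1) ≤ L := by exact_mod_cast hj
  refine pow_le_pow_left₀ (by positivity) ?_ 2
  have h := Real.mul_le_sin (x := midpointNode L j) (by unfold midpointNode; positivity) (by
    rw [midpointNode, div_le_div_iff₀ (by positivity) (by positivity)]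
    nlinarith)
  refine le_trans (le_of_eq ?_) h
  rw [midpointNode]
  field_simp

theorem tendsto_sum_dispersionRemainder (hν0 : 0 < ν) (hν1 : ν < 1) (u : ℝ) :
    Tendsto (fun L : ℕ => ∑ j ∈ Finset.range L,
        (L : ℝ) * dispersionRemainder ν (nodeWeight L j) (u / L)) atTop
      (𝓝 (2 * (√(1 - ν ^ 2) * scalingFunction (√(soundVelocity ν ^ 2 - 1) * u)))) := by
  obtain ⟨C, x₀, hC, hx₀, hbound⟩ := exists_abs_dispersionRemainder_le hν0 hν1
  set c : ℕ → ℕ → ℝ := fun L j => if 2 * j + 1 < L then 2 else if 2 * j + 1 = L then 1 else 0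
    with hc
  have hlim : ∀ j, Tendsto (fun L : ℕ => c L j * ((L : ℝ)
      * dispersionRemainder ν (nodeWeight L j) (u / L))) atTop
      (𝓝 (2 * (√(1 - ν ^ 2) * scalingTerm (√(soundVelocity ν ^ 2 - 1) * u) j))) := by
    intro j
    refine ((tendsto_mul_dispersionRemainder hν0 hν1 u j).const_mul 2).congr' ?_
    filter_upwards [eventually_gt_atTop (2 * j + 1)] with L hL
    simp only [hc, if_pos hL]
  -- All powers of L cancel in L · (C/σ) · |u/L|³ once σ ≥ ((2j + 1)/L)²; for the upper half the
  -- weight is zero.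
  have hdom : ∀ᶠ L : ℕ in atTop, ∀ j, ‖c L j * ((L : ℝ)
      * dispersionRemainder ν (nodeWeight L j) (u / L))‖
      ≤ 2 * C * |u| ^ 3 * (1 / (2 * (j : ℝ) + 1) ^ 2) := by
    have hsmall : ∀ᶠ L : ℕ in atTop, |u / (L : ℝ)| ≤ x₀ := by
      have h := (tendsto_div_nat u).abs
      rw [abs_zero] at h
      exact h.eventually (eventually_le_nhds hx₀)
    filter_upwards [hsmall, eventually_gt_atTop 0] with L hL hL0 j
    have hL' : (0 : ℝ) < L := Nat.cast_pos.2 hL0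
    by_cases hj : 2 * j + 1 ≤ L
    · have h1 := hbound (nodeWeight L j) (u / L) (nodeWeight_pos (by omega))
        (nodeWeight_le_one L j) hL
      have h2 := le_nodeWeight hj
      have hc2 : |c L j| ≤ 2 := by
        simp only [hc]
        split_ifs <;> norm_num
      have h3 : C / nodeWeight L j ≤ C / ((2 * (j : ℝ) + 1) / L) ^ 2 :=
        div_le_div_of_nonneg_left hC (by positivity) h2
      rw [Real.norm_eq_abs, abs_mul, abs_mul, abs_of_pos hL']
      calc |c L j| * ((L : ℝ) * |dispersionRemainder ν (nodeWeight L j) (u / L)|)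
          ≤ 2 * ((L : ℝ) * (C / ((2 * (j : ℝ) + 1) / L) ^ 2 * |u / L| ^ 3)) := by
            gcongr
            exact h1.trans (mul_le_mul_of_nonneg_right h3 (by positivity))
        _ = 2 * C * |u| ^ 3 * (1 / (2 * (j : ℝ) + 1) ^ 2) := by
            rw [abs_div, abs_of_pos hL']
            field_simp
    · have h1 : c L j = 0 := by
        simp only [hc]
        rw [if_neg (by omega), if_neg (by omega)]
      rw [h1, zero_mul, norm_zero]
      positivity
  have h := tendsto_tsum_of_dominated_convergence
    (summable_odd_sq.mul_left (2 * C * |u| ^ 3)) hlim hdom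
  rw [tsum_mul_left, tsum_mul_left] at h
  refine h.congr fun L => ?_
  rw [sum_eq_sum_weighted (g := fun j => (L : ℝ) * dispersionRemainder ν (nodeWeight L j) (u / L))
    fun j hj => by rw [nodeWeight_reflect hj]]
  refine tsum_eq_sum fun j hj => ?_
  have hj' : L ≤ j := by simpa using hj
  simp only [hc]
  rw [if_neg (by omega), if_neg (by omega), zero_mul]

end

/-! ### The cumulant generating function near the critical point -/

section

variable {ν : ℝ}

theorem criticalPoint_eq (ν : ℝ) : criticalPoint ν = Real.log ν := by
  rw [criticalPoint, depositionRate, jumpRate]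
  congr 1
  ring

theorem jumpRate_pos : 0 < jumpRate := by
  norm_num [jumpRate]

theorem depositionRate_pos (hν1 : ν < 1) : 0 < depositionRate ν := by
  rw [depositionRate]
  exact mul_pos jumpRate_pos (by linarith)

/-- The half angle gives cos 2q = 1 − 2σ with σ = sin² q, and ν eˣ = e^s for x = s − ln ν. -/
theorem quasiEnergy_eq (hν0 : 0 < ν) (s q : ℝ) :
    quasiEnergy (depositionRate ν) jumpRate (jumpRate * Real.exp s) (2 * q)
      = 1 / 2 * √(radicand ν (Real.sin q ^ 2) (s - Real.log ν)) := by
  have hexp : ν * Real.exp (s - Real.log ν) = Real.exp s := by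
    rw [Real.exp_sub, Real.exp_log hν0]
    field_simp
  have h2 : (1 / 2 : ℝ) = √((1 / 2) ^ 2) := by
    rw [Real.sqrt_sq (by norm_num)]
  rw [quasiEnergy, h2, ← Real.sqrt_mul (by positivity)]
  congr 1
  rw [radicand_eq, kineticEnergy, depositionRate, jumpRate, mul_assoc 2 ν, hexp,
    Real.cos_two_mul, Real.sin_two_mul, mul_pow, mul_pow, Real.cos_sq']
  ring

theorem sum_zmod_val {M : Type*} [AddCommMonoid M] (L : ℕ) [NeZero L] (g : ℕ → M) :
    ∑ m : ZMod L, g m.val = ∑ j ∈ Finset.range L, g j := by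
  rw [← sum_range_natCast_zmod L fun m => g m.val]
  exact Finset.sum_congr rfl fun j hj => by rw [ZMod.val_cast_of_lt (Finset.mem_range.1 hj)]

/-- The lattice average of the derivatives of the dispersion relation. -/
def averageJet (ν : ℝ) (L k : ℕ) (s : ℝ) : ℝ :=
  1 / (2 * L) * ∑ j ∈ Finset.range L, dispersionJet ν (nodeWeight L j) k (s - Real.log ν)

theorem cgf_eq_averageJet (hν0 : 0 < ν) (hν1 : ν < 1) {L : ℕ} (hL : 2 ≤ L) :
    cgf (depositionRate ν) jumpRate L = fun s => averageJet ν L 0 s - (1 - ν / 2) := by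
  have : NeZero L := ⟨by omega⟩
  have : Fact (1 < L) := ⟨hL⟩
  have hL' : (L : ℝ) ≠ 0 := Nat.cast_ne_zero.2 (by omega)
  funext s
  rw [cgf_eq (depositionRate_pos hν1) jumpRate_pos, dominantEigenvalue, averageJet]
  have h1 : ∀ m : ZMod L, quasiEnergy (depositionRate ν) jumpRate (jumpRate * Real.exp s)
      (momentum m) = 1 / 2 * dispersionJet ν (nodeWeight L m.val) 0 (s - Real.log ν) := by
    intro m
    have h2 : momentum m = 2 * midpointNode L m.val := by
      rw [momentum, midpointNode]
      field_simp
    rw [h2, quasiEnergy_eq hν0]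
    rfl
  simp only [h1]
  rw [← Finset.mul_sum,
    sum_zmod_val L fun j => dispersionJet ν (nodeWeight L j) 0 (s - Real.log ν), depositionRate,
    jumpRate]
  field_simp
  ring

theorem hasDerivAt_averageJet (hν0 : 0 < ν) (hν1 : ν < 1) (L : ℕ) {k : ℕ} (hk : k < 3) (s : ℝ) :
    HasDerivAt (averageJet ν L k) (averageJet ν L (k + 1) s) s := by
  unfold averageJet
  refine HasDerivAt.const_mul _ (HasDerivAt.fun_sum fun j hj => ?_)
  exact (hasDerivAt_dispersionJet hν0 hν1 (nodeWeight_pos (Finset.mem_range.1 hj))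
    (nodeWeight_le_one L j) _ hk).comp_sub_const s (Real.log ν)

theorem cumulant_one (hν0 : 0 < ν) (hν1 : ν < 1) {L : ℕ} (hL : 2 ≤ L) :
    cumulant (depositionRate ν) jumpRate 1 L = averageJet ν L 1 := by
  funext s
  rw [cumulant, iteratedDeriv_one, cgf_eq_averageJet hν0 hν1 hL]
  exact ((hasDerivAt_averageJet hν0 hν1 L (by norm_num) s).sub_const _).deriv

theorem cumulant_two (hν0 : 0 < ν) (hν1 : ν < 1) {L : ℕ} (hL : 2 ≤ L) :
    cumulant (depositionRate ν) jumpRate 2 L = averageJet ν L 2 := by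
  funext s
  have h : iteratedDeriv 1 (cgf (depositionRate ν) jumpRate L) = averageJet ν L 1 :=
    cumulant_one hν0 hν1 hL
  rw [cumulant, iteratedDeriv_succ, h]
  exact (hasDerivAt_averageJet hν0 hν1 L (by norm_num) s).deriv

/-- At x = 0 the radicand factors as (2 sin q)² (1 − ν² cos² q), and sin q is positive at the nodes.
-/
theorem dispersionJet_zero_zero {L j : ℕ} (hj : j < L) :
    dispersionJet ν (nodeWeight L j) 0 0 = criticalDispersion ν (midpointNode L j) := by
  have hs := sin_midpointNode_pos hj
  have h : radicand ν (nodeWeight L j) 0 = (2 * Real.sin (midpointNode L j)) ^ 2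
      * (1 - ν ^ 2 * Real.cos (midpointNode L j) ^ 2) := by
    rw [radicand, nodeWeight, Real.exp_zero, Real.cos_sq']
    ring
  change √(radicand ν (nodeWeight L j) 0) = _
  rw [h, Real.sqrt_mul (by positivity), Real.sqrt_sq (by positivity), criticalDispersion]

/-- The first two cumulants average the first two derivatives at x = 0, so subtracting them leaves
the Taylor remainder of each mode and the midpoint error at x = 0. The part ν/2 − 1 of κ₀* cancels
−(μ + w). -/
theorem sq_mul_K0 (hν0 : 0 < ν) (hν1 : ν < 1) (u : ℝ) {L : ℕ} (hL : 2 ≤ L) :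
    (L : ℝ) ^ 2 * K0 ν L u = soundVelocity ν
      * ((L : ℝ) ^ 2 * (1 / (2 * L)
          * ∑ j ∈ Finset.range L, criticalDispersion ν (midpointNode L j)
          - 1 / Real.pi * (Real.arcsin ν / ν + √(1 - ν ^ 2)))
        + 1 / 2 * ∑ j ∈ Finset.range L,
          (L : ℝ) * dispersionRemainder ν (nodeWeight L j) (u / L)) := by
  have hL' : (L : ℝ) ≠ 0 := Nat.cast_ne_zero.2 (by omega)
  have h0 : ∑ j ∈ Finset.range L, criticalDispersion ν (midpointNode L j)
      = ∑ j ∈ Finset.range L, dispersionJet ν (nodeWeight L j) 0 0 :=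
    Finset.sum_congr rfl fun j hj => (dispersionJet_zero_zero (Finset.mem_range.1 hj)).symm
  rw [K0, cumulant_one hν0 hν1 hL, cumulant_two hν0 hν1 hL, cgf_eq_averageJet hν0 hν1 hL, h0,
    ← Finset.mul_sum]
  simp only [averageJet, criticalPoint_eq, sub_self, add_sub_cancel_left, dispersionRemainder,
    Finset.sum_sub_distrib, ← Finset.mul_sum, kappaStarZero]
  field_simp
  ring

theorem tendsto_sq_mul_K0 (hν0 : 0 < ν) (hν1 : ν < 1) (u : ℝ) :
    Tendsto (fun L : ℕ => (L : ℝ) ^ 2 * K0 ν L u) atTop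
      (𝓝 (Real.pi * centralCharge / 6 + scalingFunction (√(soundVelocity ν ^ 2 - 1) * u))) := by
  have hs : 0 < √(1 - ν ^ 2) := Real.sqrt_pos.2 (by nlinarith)
  have h := ((tendsto_critical_sum hν0 hν1).add
    ((tendsto_sum_dispersionRemainder hν0 hν1 u).const_mul (1 / 2))).const_mul (soundVelocity ν)
  have e : soundVelocity ν * (Real.pi / 12 * √(1 - ν ^ 2)
      + 1 / 2 * (2 * (√(1 - ν ^ 2) * scalingFunction (√(soundVelocity ν ^ 2 - 1) * u))))
      = Real.pi * centralCharge / 6 + scalingFunction (√(soundVelocity ν ^ 2 - 1) * u) := by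
    have hξ : soundVelocity ν * √(1 - ν ^ 2) = 1 := by
      rw [soundVelocity]
      field_simp
    rw [centralCharge]
    linear_combination (Real.pi / 12 + scalingFunction (√(soundVelocity ν ^ 2 - 1) * u)) * hξ
  rw [e] at h
  refine h.congr' ?_
  filter_upwards [eventually_ge_atTop 2] with L hL
  exact (sq_mul_K0 hν0 hν1 u hL).symm

end

end DLPAD

end

theorem theorem2 (ν : ℝ) (hν0 : 0 < ν) (hν1 : ν < 1) :
    -- for `L ≥ 2` the moment generating function is finite, and the limit that defines the
    -- cumulant generating function exists and is the same for all even initial configurations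
    (∀ L : ℕ, 2 ≤ L → ∀ (s : ℝ) (η : DLPAD.Config L), Even (DLPAD.particleNumber η) →
      (∀ t : ℝ, 0 ≤ t → Summable fun y : DLPAD.JointState L =>
        Real.exp (s * y.2) *
          DLPAD.transitionProb (DLPAD.depositionRate ν) DLPAD.jumpRate L t (η, 0) y) ∧
      Tendsto (fun t : ℝ =>
          DLPAD.scaledLogMGF (DLPAD.depositionRate ν) DLPAD.jumpRate L η s t)
        atTop (𝓝 (DLPAD.cgf (DLPAD.depositionRate ν) DLPAD.jumpRate L s))) ∧
    -- the cumulants are well defined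
    (∀ L : ℕ, 2 ≤ L → ContDiff ℝ ∞ (DLPAD.cgf (DLPAD.depositionRate ν) DLPAD.jumpRate L)) ∧
    -- the series that defines the scaling function converges
    (∀ u : ℝ, Summable (DLPAD.scalingTerm u)) ∧
    -- the universal scaling limit
    (∀ u : ℝ, Tendsto (fun L : ℕ => (L : ℝ) ^ 2 * DLPAD.K0 ν L u) atTop
      (𝓝 (Real.pi * DLPAD.centralCharge / 6
        + DLPAD.scalingFunction (√(DLPAD.soundVelocity ν ^ 2 - 1) * u)))) := by
  have hμ := DLPAD.depositionRate_pos hν1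
  have hw := DLPAD.jumpRate_pos
  refine ⟨fun L hL s η hη => ?_, fun L hL => ?_, DLPAD.summable_scalingTerm,
    DLPAD.tendsto_sq_mul_K0 hν0 hν1⟩
  · have : NeZero L := ⟨by omega⟩
    have : Fact (1 < L) := ⟨hL⟩
    have hparity := DLPAD.paritySign_of_even hη
    refine ⟨fun t ht => (DLPAD.hasSum_activityMGF hμ hw s hparity ht).1, ?_⟩
    rw [DLPAD.cgf_eq hμ hw s]
    exact DLPAD.tendsto_scaledLogMGF hμ hw s hparity
  · have : NeZero L := ⟨by omega⟩
    have : Fact (1 < L) := ⟨hL⟩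
    exact DLPAD.contDiff_cgf hμ hw
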